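/- All systems are finite-dimensional of dimension at least one, with parties Alice ($A$) and Bob ($B$). A product Hamiltonian is $H=H_A\otimes H_B$ with $H_A,H_B$ Hermitian; a Hamiltonian is local if it has the form $L_A\otimes I+I\otimes L_B$ with $L_A,L_B$ Hermitian, and nonlocal otherwise. $H$ on $AB$ simulates $H'$ on $A'B'$ at rate $r>0$ if for all $\tau>0$, $N\in\mathbb N$, $\varepsilon>0$ there are finite-dimensional local ancillas, a product initial state of all systems other than the register $A'B'$, and a protocol of consecutive blocks, each alternating evolutions under $H$ (acting on $AB$) with instantaneous local unitaries $U_A\otimes U_B$ (on all systems held by Alice and Bob, respectively) and using $H$ for total time exactly $\tau/r$, such that for every $0\le k\le N$ the first $k$ blocks map each unit input state $\psi$ of $A'B'$ to $(e^{-iH'k\tau}\psi)\otimes\chi_k$ up to norm error $\varepsilon$, for some unit vector $\chi_k$ not depending on $\psi$. Let $\gamma_{H'|H}\in[0,\infty]$ be the supremum of these rates ($0$ if there are none). Write $H\longleftrightarrow H'$ if $\gamma_{H'|H}\,\gamma_{H|H'}=1$ and both (then finite and positive) optimal rates are attained. Let $K_\otimes(H):=\gamma_{\sigma_z\otimes\sigma_z|H}$.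 For Hamiltonians on different pairs of systems, $H_1\boxplus H_2=H_1\otimes I_{A_2B_2}+I_{A_1B_1}\otimes H_2$, and $\boxplus_iH_i$ is defined likewise for finite families. (1) If $H_1,H_2,H'$ are product Hamiltonians, then $\gamma_{H'|H_1\boxplus H_2}=\gamma_{H'|H_1}+\gamma_{H'|H_2}$. If moreover $H'$ is nonlocal and at least one of $H_1,H_2$ is nonlocal, then $H_1\boxplus H_2\longleftrightarrow H'$. (2) If $H_1,H_2$ are product Hamiltonians, then $K_\otimes(H_1\boxplus H_2)=K_\otimes(H_1)+K_\otimes(H_2)$. (3) Let $(H_i)_{i\in I}$ and $(H'_j)_{j\in J}$ be finite families of product Hamiltonians, some $H'_j$ being nonlocal, and let $H=\boxplus_iH_i$, $H'=\boxplus_jH'_j$. Then $$\gamma_{H'|H}=\frac{\sum_iK_\otimes(H_i)}{\sum_jK_\otimes(H'_j)},$$ and if also some $H_i$ is nonlocal, then $H\longleftrightarrow H'$. -/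

import Mathlib

open scoped Kronecker ENNReal

noncomputable section

namespace HamSim

/-- The `ℓ²` (Hilbert space) norm of a vector given by its coordinates. -/
def l2norm {ι : Type*} [Fintype ι] (v : ι → ℂ) : ℝ :=
  ‖(WithLp.toLp 2 v : EuclideanSpace ℂ ι)‖

/-- The time evolution `exp (-i t H)`. -/
def evolution {ι : Type*} [Fintype ι] [DecidableEq ι] (H : Matrix ι ι ℂ) (t : ℝ) :
    Matrix ι ι ℂ :=
  NormedSpace.exp ((-(Complex.I * (t : ℂ))) • H)

/-- A product Hamiltonian `H_A ⊗ H_B` on a bipartite system `AB`. -/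
def IsProductHamiltonian {a b : Type*} (H : Matrix (a × b) (a × b) ℂ) : Prop :=
  ∃ (HA : Matrix a a ℂ) (HB : Matrix b b ℂ), HA.IsHermitian ∧ HB.IsHermitian ∧ H = HA ⊗ₖ HB

/-- A local Hamiltonian `H_A ⊗ 1 + 1 ⊗ H_B`; `H` is nonlocal when this fails. -/
def IsLocalHamiltonian {a b : Type*} [DecidableEq a] [DecidableEq b]
    (H : Matrix (a × b) (a × b) ℂ) : Prop :=
  ∃ (HA : Matrix a a ℂ) (HB : Matrix b b ℂ), HA.IsHermitian ∧ HB.IsHermitian ∧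
    H = HA ⊗ₖ (1 : Matrix b b ℂ) + (1 : Matrix a a ℂ) ⊗ₖ HB

/-- `H ⊗ 1` on the bipartite system whose parties hold `A, U` and `B, V` respectively. -/
def withAncillas {a b : Type*} (u v : Type*) [DecidableEq u] [DecidableEq v]
    (H : Matrix (a × b) (a × b) ℂ) : Matrix ((a × u) × (b × v)) ((a × u) × (b × v)) ℂ :=
  (H ⊗ₖ (1 : Matrix (u × v) (u × v) ℂ)).submatrix
    (Equiv.prodProdProdComm a u b v) (Equiv.prodProdProdComm a u b v)

/-- The sum `H₁ ⊞ H₂ = H₁ ⊗ 1 + 1 ⊗ H₂` of two Hamiltonians acting on different pairs of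
systems `A₁B₁` and `A₂B₂`; Alice holds `A₁A₂` and Bob holds `B₁B₂`. -/
def boxPlus {a₁ b₁ a₂ b₂ : Type*} [DecidableEq a₁] [DecidableEq b₁] [DecidableEq a₂]
    [DecidableEq b₂] (H₁ : Matrix (a₁ × b₁) (a₁ × b₁) ℂ) (H₂ : Matrix (a₂ × b₂) (a₂ × b₂) ℂ) :
    Matrix ((a₁ × a₂) × (b₁ × b₂)) ((a₁ × a₂) × (b₁ × b₂)) ℂ :=
  (H₁ ⊗ₖ (1 : Matrix (a₂ × b₂) (a₂ × b₂) ℂ) + (1 : Matrix (a₁ × b₁) (a₁ × b₁) ℂ) ⊗ₖ H₂).submatrix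
    (Equiv.prodProdProdComm a₁ a₂ b₁ b₂) (Equiv.prodProdProdComm a₁ a₂ b₁ b₂)

/-- The sum `⊞ᵢ Hᵢ` of a finite family of Hamiltonians acting on different pairs of systems
`AᵢBᵢ`: each summand acts as `Hᵢ` on `AᵢBᵢ` and as the identity on all the other systems. -/
def bigBoxPlus {ι : Type*} [Fintype ι] [DecidableEq ι] {a b : ι → Type*}
    [∀ i, DecidableEq (a i)] [∀ i, DecidableEq (b i)]
    (H : ∀ i, Matrix (a i × b i) (a i × b i) ℂ) :
    Matrix ((∀ i, a i) × (∀ i, b i)) ((∀ i, a i) × (∀ i, b i)) ℂ :=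
  Matrix.of fun p q => ∑ i,
    if ∀ j, j ≠ i → p.1 j = q.1 j ∧ p.2 j = q.2 j
    then H i (p.1 i, p.2 i) (q.1 i, q.2 i) else 0

/-- One step of a protocol: let the given Hamiltonian act for the time `time`, then apply
instantaneously the local unitary `uA ⊗ uB`. -/
structure Step (x y : Type*) [Fintype x] [DecidableEq x] [Fintype y] [DecidableEq y] where
  time : ℝ
  time_nonneg : 0 ≤ time
  uA : Matrix.unitaryGroup x ℂ
  uB : Matrix.unitaryGroup y ℂ

section Protocol

variable {x y : Type*} [Fintype x] [DecidableEq x] [Fintype y] [DecidableEq y]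

/-- The unitary performed by one step when the available Hamiltonian is `G`. -/
def Step.op (G : Matrix (x × y) (x × y) ℂ) (s : Step x y) : Matrix (x × y) (x × y) ℂ :=
  ((s.uA : Matrix x x ℂ) ⊗ₖ (s.uB : Matrix y y ℂ)) * evolution G s.time

/-- The unitary performed by a list of steps; the head of the list comes first in time. -/
def runOp (G : Matrix (x × y) (x × y) ℂ) : List (Step x y) → Matrix (x × y) (x × y) ℂ
  | [] => 1
  | s :: l => runOp G l * s.op G

/-- The total time for which the given Hamiltonian is used. -/
def totalTime (l : List (Step x y)) : ℝ := (l.map Step.time).sum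

end Protocol

/-- The joint state `ψ ⊗ χ`, where `ψ` is a state of the register `A'B'` that carries the simulated
system, and `χ` is a state of everything else: `A` and an ancilla `M` on Alice's side, `B` and an
ancilla `N` on Bob's side. -/
def jointState {a b a' b' m n : Type*} (ψ : a' × b' → ℂ) (χ : (a × m) × (b × n) → ℂ) :
    (a × (a' × m)) × (b × (b' × n)) → ℂ :=
  fun p => ψ (p.1.2.1, p.2.2.1) * χ ((p.1.1, p.1.2.2), (p.2.1, p.2.2.2))

/-- `Simulates H H' r`: with local unitaries and local ancillas, the Hamiltonian `H` on `AB` can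
simulate the Hamiltonian `H'` on `A'B'` at rate `r > 0`.

For every spacing `τ > 0`, every number `N` of checkpoints and every accuracy `ε > 0` there are
finite-dimensional local ancillas, a product initial state `α ⊗ β` of all the systems other than
the register `A'B'`, and a protocol made of consecutive blocks, each of which uses `H` for the
total time `τ / r`, such that for each `k ≤ N` the first `k` blocks realise the evolution
`exp (-i k τ H')` on the register, up to the error `ε`, uniformly in the input state `ψ`.
The state `χ` in which the other systems are left (they may be discarded) is arbitrary, but does
not depend on `ψ`. -/
def Simulates {a b a' b' : Type*} [Fintype a] [DecidableEq a] [Fintype b] [DecidableEq b]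
    [Fintype a'] [DecidableEq a'] [Fintype b'] [DecidableEq b']
    (H : Matrix (a × b) (a × b) ℂ) (H' : Matrix (a' × b') (a' × b') ℂ) (r : ℝ) : Prop :=
  0 < r ∧ ∀ (τ : ℝ) (N : ℕ) (ε : ℝ), 0 < τ → 0 < ε →
    ∃ (m n : ℕ) (α : a × Fin m → ℂ) (β : b × Fin n → ℂ)
      (block : ℕ → List (Step (a × (a' × Fin m)) (b × (b' × Fin n)))),
      l2norm α = 1 ∧ l2norm β = 1 ∧
      (∀ k, k < N → totalTime (block k) = τ / r) ∧
      ∀ k, k ≤ N → ∃ χ : (a × Fin m) × (b × Fin n) → ℂ, l2norm χ = 1 ∧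
        ∀ ψ : a' × b' → ℂ, l2norm ψ = 1 →
          l2norm
            ((runOp (withAncillas (a' × Fin m) (b' × Fin n) H)
                ((List.range k).flatMap block)).mulVec
                (jointState ψ (fun q => α q.1 * β q.2))
              - jointState ((evolution H' (k * τ)).mulVec ψ) χ) ≤ ε

section Rate

variable {a b a' b' : Type*} [Fintype a] [DecidableEq a] [Fintype b] [DecidableEq b]
  [Fintype a'] [DecidableEq a'] [Fintype b'] [DecidableEq b']

/-- The optimal rate `γ_{H'|H}` at which `H` can simulate `H'` (`0` if no positive rate is possible,
`∞` if the rates are unbounded). -/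
def simRate (H : Matrix (a × b) (a × b) ℂ) (H' : Matrix (a' × b') (a' × b') ℂ) : ℝ≥0∞ :=
  sSup (ENNReal.ofReal '' {r : ℝ | Simulates H H' r})

/-- `H ⟷ H'`: each of `H`, `H'` can simulate the other at the optimal rate, and the two optimal rates
satisfy `γ_{H'|H} * γ_{H|H'} = 1` (in particular, both are positive and finite). -/
def ReversiblySimulates (H : Matrix (a × b) (a × b) ℂ) (H' : Matrix (a' × b') (a' × b') ℂ) : Prop :=
  Simulates H H' (simRate H H').toReal ∧ Simulates H' H (simRate H' H).toReal ∧
    simRate H H' * simRate H' H = 1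

/-- The Pauli matrix `σ_z`. -/
def sigmaZ : Matrix (Fin 2) (Fin 2) ℂ := !![1, 0; 0, -1]

/-- The Ising interaction `σ_z ⊗ σ_z` of two qubits. -/
def ising : Matrix (Fin 2 × Fin 2) (Fin 2 × Fin 2) ℂ := sigmaZ ⊗ₖ sigmaZ

/-- `K_⊗(H)`, the optimal rate at which `H` can simulate the Ising interaction. -/
def Kprod (H : Matrix (a × b) (a × b) ℂ) : ℝ≥0∞ := simRate H ising

end Rate

end HamSim

end

set_option linter.unusedSectionVars false

/-! Up to local unitaries a product Hamiltonian is diagonal with eigenvalues `x k * y l`. Centring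
each factor at the midpoint of its spectrum splits this into local terms plus `c * m k l`. Here `c`
is a quarter of the product of the two spectral spreads, and `m` lies in the convex hull of the sign
products and equals the Ising sign pattern on some two rows and two columns. This shape
(`IsingLike`) survives sums over different systems, and the strengths `c` add (`IsingLike.add`,
`IsingLike.sum`). All claims therefore reduce to one formula: for `c' > 0` the optimal rate is `c /
c'` (`HasIsingStrength.simRate_eq`).

The rate is attained exactly (`simulates_diagHam`). A swap controlled by the register steers the
system to one of the four corners, so any sign product can be imprinted as a phase. Diagonal phases
add, so splitting the time reaches every convex combination, and local terms are corrected by local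
unitaries at no cost in time.

For optimality (`HasIsingStrength.rate_le`), simulation is transitive with multiplying rates
(`Simulates.trans`). A rate `r > c / c'` with `c > 0` would let `H'` simulate itself at the rate `c'
/ c * r > 1`; iterating, `H'` would simulate the Ising interaction at arbitrarily high rates. This
is impossible (`exists_bound_simulates_ising`): a short protocol is close to a product unitary,
which cannot create the entanglement that the Ising evolution creates. If `c = 0`, then `H` is local
and can itself be simulated by the zero Hamiltonian at any rate, with the same contradiction.

Transitivity is where the checkpoints matter. A protocol for the intermediate Hamiltonian is cut
into equal time slots, and each slot is replaced by one block of the simulation of that Hamiltonian.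
Local targets (`c' = 0`) are separate: their rate is infinite, because local unitaries alone do the
work. -/

namespace HamSim

/-! ### Hilbert space norms and operator bounds. -/

section Norm

variable {ι κ ζ : Type*} [Fintype ι] [Fintype κ] [Fintype ζ]

lemma l2norm_nonneg (v : ι → ℂ) : 0 ≤ l2norm v := norm_nonneg _

lemma l2norm_sq (v : ι → ℂ) : l2norm v ^ 2 = ∑ i, ‖v i‖ ^ 2 := by
  simp [l2norm, EuclideanSpace.norm_sq_eq]

lemma l2norm_add_le (v w : ι → ℂ) : l2norm (v + w) ≤ l2norm v + l2norm w := by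
  simpa [l2norm] using norm_add_le (WithLp.toLp 2 v) (WithLp.toLp 2 w)

lemma l2norm_sub_le (u v w : ι → ℂ) : l2norm (u - w) ≤ l2norm (u - v) + l2norm (v - w) := by
  simpa using l2norm_add_le (u - v) (v - w)

lemma l2norm_sub_comm (v w : ι → ℂ) : l2norm (v - w) = l2norm (w - v) := by
  simpa [l2norm] using norm_sub_rev (WithLp.toLp 2 v) (WithLp.toLp 2 w)

lemma l2norm_smul (c : ℂ) (v : ι → ℂ) : l2norm (c • v) = ‖c‖ * l2norm v := by
  simpa [l2norm] using norm_smul c (WithLp.toLp 2 v)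

lemma l2norm_zero : l2norm (0 : ι → ℂ) = 0 := by simp [l2norm]

lemma l2norm_eq_zero {v : ι → ℂ} : l2norm v = 0 ↔ v = 0 := by simp [l2norm]

lemma l2norm_eq_of_sq {v : ι → ℂ} {w : κ → ℂ} (h : ∑ i, ‖v i‖ ^ 2 = ∑ i, ‖w i‖ ^ 2) :
    l2norm v = l2norm w := by
  rw [← sq_eq_sq₀ (l2norm_nonneg _) (l2norm_nonneg _), l2norm_sq, l2norm_sq, h]

lemma l2norm_comp_equiv (e : ι ≃ κ) (v : κ → ℂ) : l2norm (fun i => v (e i)) = l2norm v :=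
  l2norm_eq_of_sq (Equiv.sum_comp e fun k => ‖v k‖ ^ 2)

lemma l2norm_mul (v : ι → ℂ) (w : κ → ℂ) :
    l2norm (fun p : ι × κ => v p.1 * w p.2) = l2norm v * l2norm w := by
  rw [← sq_eq_sq₀ (l2norm_nonneg _) (mul_nonneg (l2norm_nonneg _) (l2norm_nonneg _)), mul_pow,
    l2norm_sq, l2norm_sq, l2norm_sq, Fintype.sum_prod_type, Finset.sum_mul_sum]
  simp [mul_pow]

/-- The squared norm is the sum over the slices; this handles operators that act trivially on one
tensor factor. -/
lemma l2norm_le_of_slices {v : ι × ζ → ℂ} {w : κ × ζ → ℂ} {C : ℝ} (hC : 0 ≤ C)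
    (h : ∀ z, l2norm (fun i => v (i, z)) ≤ C * l2norm (fun k => w (k, z))) :
    l2norm v ≤ C * l2norm w := by
  refine (sq_le_sq₀ (l2norm_nonneg _) (mul_nonneg hC (l2norm_nonneg _))).1 ?_
  rw [mul_pow, l2norm_sq, l2norm_sq, Fintype.sum_prod_type_right, Fintype.sum_prod_type_right,
    Finset.mul_sum]
  refine Finset.sum_le_sum fun z _ => ?_
  have := (sq_le_sq₀ (l2norm_nonneg _) (mul_nonneg hC (l2norm_nonneg _))).2 (h z)
  rwa [mul_pow, l2norm_sq, l2norm_sq] at this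

lemma norm_sum_mul_le (s v w : ι → ℂ) (hs : ∀ i, ‖s i‖ ≤ 1) :
    ‖∑ i, s i * (v i * w i)‖ ≤ l2norm v * l2norm w := by
  calc ‖∑ i, s i * (v i * w i)‖ ≤ ∑ i, ‖v i‖ * ‖w i‖ := by
        refine (norm_sum_le _ _).trans (Finset.sum_le_sum fun i _ => ?_)
        rw [norm_mul, norm_mul]
        exact mul_le_of_le_one_left (by positivity) (hs i)
    _ ≤ Real.sqrt (∑ i, ‖v i‖ ^ 2) * Real.sqrt (∑ i, ‖w i‖ ^ 2) :=
        Real.sum_mul_le_sqrt_mul_sqrt _ _ _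
    _ = l2norm v * l2norm w := by
        rw [← l2norm_sq, ← l2norm_sq, Real.sqrt_sq (l2norm_nonneg _),
          Real.sqrt_sq (l2norm_nonneg _)]

/-- `C` bounds the operator norm of `M`. -/
def OpBound (M : Matrix ι ι ℂ) (C : ℝ) : Prop :=
  0 ≤ C ∧ ∀ v, l2norm (M.mulVec v) ≤ C * l2norm v

open scoped Matrix.Norms.L2Operator in
lemma exists_opBound [DecidableEq ι] (M : Matrix ι ι ℂ) : ∃ C, OpBound M C :=
  ⟨‖M‖, norm_nonneg _, fun v => Matrix.l2_opNorm_mulVec M (WithLp.toLp 2 v)⟩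

lemma l2norm_mulVec_unitary [DecidableEq ι] {U : Matrix ι ι ℂ} (hU : U ∈ Matrix.unitaryGroup ι ℂ)
    (v : ι → ℂ) : l2norm (U.mulVec v) = l2norm v := by
  have key : ∀ w : ι → ℂ, ((l2norm w ^ 2 : ℝ) : ℂ) = star w ⬝ᵥ w := by
    intro w
    rw [l2norm_sq, dotProduct]
    push_cast
    refine Finset.sum_congr rfl fun i _ => ?_
    simp [Complex.conj_mul']
  rw [← sq_eq_sq₀ (l2norm_nonneg _) (l2norm_nonneg _)]
  apply Complex.ofReal_injective
  rw [key, key, Matrix.star_mulVec, ← Matrix.dotProduct_mulVec, Matrix.mulVec_mulVec,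
    ← Matrix.star_eq_conjTranspose, Matrix.mem_unitaryGroup_iff'.1 hU, Matrix.one_mulVec]

end Norm

/-! ### The unitary group generated by a Hamiltonian. -/

section Evolution

variable {ι κ : Type*} [Fintype ι] [DecidableEq ι] [Fintype κ] [DecidableEq κ]

lemma evolution_zero_time (H : Matrix ι ι ℂ) : evolution H 0 = 1 := by
  simp [evolution]

lemma evolution_add (H : Matrix ι ι ℂ) (s t : ℝ) :
    evolution H (s + t) = evolution H s * evolution H t := by
  rw [evolution, evolution, evolution, ← Matrix.exp_add_of_commute, ← add_smul]
  · congr 2; push_cast; ring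
  · exact (Commute.refl H).smul_left _ |>.smul_right _

lemma evolution_add_of_commute {H K : Matrix ι ι ℂ} (h : Commute H K) (t : ℝ) :
    evolution (H + K) t = evolution H t * evolution K t := by
  rw [evolution, evolution, evolution, ← Matrix.exp_add_of_commute, ← smul_add]
  exact h.smul_left _ |>.smul_right _

lemma evolution_mem_unitary {H : Matrix ι ι ℂ} (hH : H.IsHermitian) (t : ℝ) :
    evolution H t ∈ Matrix.unitaryGroup ι ℂ := by
  rw [Matrix.mem_unitaryGroup_iff]
  have : star (evolution H t) = evolution H (-t) := by
    rw [Matrix.star_eq_conjTranspose, evolution, evolution, ← Matrix.exp_conjTranspose,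
      Matrix.conjTranspose_smul, hH.eq]
    congr 2
    simp
  rw [this, ← evolution_add, add_neg_cancel, evolution_zero_time]

lemma evolution_map (f : Matrix ι ι ℂ →ₐ[ℂ] Matrix κ κ ℂ) (H : Matrix ι ι ℂ) (t : ℝ) :
    f (evolution H t) = evolution (f H) t := by
  have hf : Continuous f := f.toLinearMap.continuous_of_finiteDimensional
  rw [evolution, evolution, ← map_smul]
  open scoped Matrix.Norms.L2Operator in
  let _ : NormedAlgebra ℚ (Matrix ι ι ℂ) := NormedAlgebra.restrictScalars ℚ ℂ _
  exact NormedSpace.map_exp f hf _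

lemma evolution_diagonal (d : ι → ℂ) (t : ℝ) :
    evolution (Matrix.diagonal d) t =
      Matrix.diagonal fun i => Complex.exp (-(Complex.I * t) * d i) := by
  rw [evolution, ← Matrix.diagonal_smul, Matrix.exp_diagonal]
  congr 1
  ext i
  rw [Pi.coe_exp]
  simp [Complex.exp_eq_exp_ℂ]

lemma evolution_conj {U : Matrix ι ι ℂ} (hU : U ∈ Matrix.unitaryGroup ι ℂ) (H : Matrix ι ι ℂ)
    (t : ℝ) : evolution (U * H * star U) t = U * evolution H t * star U := by
  have h1 : U⁻¹ = star U := Matrix.inv_eq_right_inv (Matrix.mem_unitaryGroup_iff.1 hU)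
  have h2 : IsUnit U := (Matrix.isUnit_iff_isUnit_det _).2 (Matrix.UnitaryGroup.det_isUnit ⟨U, hU⟩)
  rw [evolution, evolution, ← h1, ← Matrix.exp_conj U _ h2]
  simp

open scoped Matrix.Norms.L2Operator in
-- Mean value inequality: the derivative of the orbit is a unitary applied to `-i H v`, hence has
-- norm at most `C * l2norm v`.
lemma l2norm_evolution_sub_le {H : Matrix ι ι ℂ} (hH : H.IsHermitian) {C : ℝ} (hC : OpBound H C)
    {s t : ℝ} (hst : s ≤ t) (v : ι → ℂ) :
    l2norm ((evolution H t).mulVec v - (evolution H s).mulVec v) ≤ (t - s) * C * l2norm v := by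
  have hd : ∀ r : ℝ, HasDerivAt (fun r : ℝ => evolution H r)
      (evolution H r * (-Complex.I • H)) r := by
    intro r
    have := hasDerivAt_exp_smul_const (𝕂 := ℝ) (-Complex.I • H) r
    have e : ∀ r : ℝ, evolution H r = NormedSpace.exp (r • (-Complex.I • H)) := by
      intro r
      rw [evolution]
      congr 1
      ext i j
      simp
      ring
    simp_rw [e]
    exact this
  let T : Matrix ι ι ℂ →ₗ[ℝ] EuclideanSpace ℂ ι :=
    { toFun := fun M => WithLp.toLp 2 (M.mulVec v)
      map_add' := fun M N => by simp [Matrix.add_mulVec]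
      map_smul' := fun c M => by simp [Matrix.smul_mulVec] }
  let T' : Matrix ι ι ℂ →L[ℝ] EuclideanSpace ℂ ι := ⟨T, T.continuous_of_finiteDimensional⟩
  have hd' : ∀ r : ℝ, HasDerivAt (fun r : ℝ => T' (evolution H r))
      (T' (evolution H r * (-Complex.I • H))) r := fun r =>
    T'.hasFDerivAt.comp_hasDerivAt r (hd r)
  have := norm_image_sub_le_of_norm_deriv_le_segment' (a := s) (b := t) (C := C * l2norm v)
    (fun r _ => (hd' r).hasDerivWithinAt) (fun r _ => ?_) t ⟨hst, le_rfl⟩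
  · calc _ ≤ C * l2norm v * (t - s) := this
      _ = _ := by ring
  · change l2norm ((evolution H r * (-Complex.I • H)).mulVec v) ≤ _
    rw [← Matrix.mulVec_mulVec, l2norm_mulVec_unitary (evolution_mem_unitary hH r),
      Matrix.smul_mulVec, l2norm_smul]
    simpa using hC.2 v

end Evolution

/-! ### Unitaries reachable by a protocol in a given time. -/

noncomputable section Reachable

variable {x y x' y' : Type*} [Fintype x] [DecidableEq x] [Fintype y] [DecidableEq y]
  [Fintype x'] [DecidableEq x'] [Fintype y'] [DecidableEq y']

/-- `V` can be performed with local unitaries, using `G` for the total time `t`. -/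
def Reach (G : Matrix (x × y) (x × y) ℂ) (t : ℝ) (V : Matrix (x × y) (x × y) ℂ) : Prop :=
  ∃ l : List (Step x y), totalTime l = t ∧ runOp G l = V

lemma runOp_append (G : Matrix (x × y) (x × y) ℂ) (l₁ l₂ : List (Step x y)) :
    runOp G (l₁ ++ l₂) = runOp G l₂ * runOp G l₁ := by
  induction l₁ with
  | nil => simp [runOp]
  | cons s l ih => simp [runOp, ih, mul_assoc]

lemma Reach.one (G : Matrix (x × y) (x × y) ℂ) : Reach G 0 1 := ⟨[], by simp [totalTime], rfl⟩

lemma Reach.mul {G : Matrix (x × y) (x × y) ℂ} {s t : ℝ} {V W : Matrix (x × y) (x × y) ℂ}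
    (hV : Reach G s V) (hW : Reach G t W) : Reach G (s + t) (W * V) := by
  obtain ⟨l₁, rfl, rfl⟩ := hV
  obtain ⟨l₂, rfl, rfl⟩ := hW
  exact ⟨l₁ ++ l₂, by simp [totalTime], runOp_append _ _ _⟩

lemma Reach.step (G : Matrix (x × y) (x × y) ℂ) {t : ℝ} (ht : 0 ≤ t) {A : Matrix x x ℂ}
    {B : Matrix y y ℂ} (hA : A ∈ Matrix.unitaryGroup x ℂ) (hB : B ∈ Matrix.unitaryGroup y ℂ) :
    Reach G t ((A ⊗ₖ B) * evolution G t) :=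
  ⟨[⟨t, ht, ⟨A, hA⟩, ⟨B, hB⟩⟩], by simp [totalTime], by simp [runOp, Step.op]⟩

lemma Reach.loc (G : Matrix (x × y) (x × y) ℂ) {A : Matrix x x ℂ}
    {B : Matrix y y ℂ} (hA : A ∈ Matrix.unitaryGroup x ℂ) (hB : B ∈ Matrix.unitaryGroup y ℂ) :
    Reach G 0 (A ⊗ₖ B) := by
  simpa [evolution_zero_time] using Reach.step G le_rfl hA hB

lemma Reach.evolution (G : Matrix (x × y) (x × y) ℂ) {t : ℝ} (ht : 0 ≤ t) :
    Reach G t (evolution G t) := by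
  simpa using Reach.step G ht (one_mem (Matrix.unitaryGroup x ℂ))
    (one_mem (Matrix.unitaryGroup y ℂ))

/-- The step split off is the first in time, hence the rightmost factor. Reachability of the
remainder stays available, since its unitarity and the sign of its time are needed in later
inductions. -/
lemma Reach.induction {G : Matrix (x × y) (x × y) ℂ}
    {p : ℝ → Matrix (x × y) (x × y) ℂ → Prop} (one : p 0 1)
    (step : ∀ t V s A B, 0 ≤ s → A ∈ Matrix.unitaryGroup x ℂ → B ∈ Matrix.unitaryGroup y ℂ →
      Reach G t V → p t V → p (s + t) (V * ((A ⊗ₖ B) * HamSim.evolution G s)))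
    {t : ℝ} {V : Matrix (x × y) (x × y) ℂ} (h : Reach G t V) : p t V := by
  obtain ⟨l, rfl, rfl⟩ := h
  induction l with
  | nil => simpa [totalTime, runOp] using one
  | cons s l ih =>
    have := step _ _ s.time s.uA s.uB s.time_nonneg s.uA.2 s.uB.2 ⟨l, rfl, rfl⟩ ih
    simpa [totalTime, runOp, Step.op] using this

lemma Reach.time_nonneg {G : Matrix (x × y) (x × y) ℂ} {t : ℝ} {V : Matrix (x × y) (x × y) ℂ}
    (h : Reach G t V) : 0 ≤ t :=
  h.induction (p := fun t _ => 0 ≤ t) le_rfl fun _ _ _ _ _ hs _ _ _ ht => add_nonneg hs ht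

lemma Reach.mem_unitary {G : Matrix (x × y) (x × y) ℂ} (hG : G.IsHermitian) {t : ℝ}
    {V : Matrix (x × y) (x × y) ℂ} (h : Reach G t V) : V ∈ Matrix.unitaryGroup (x × y) ℂ :=
  h.induction (p := fun _ V => V ∈ Matrix.unitaryGroup (x × y) ℂ) (one_mem _)
    fun _ _ s _ _ _ hA hB _ hV =>
      mul_mem hV (mul_mem (Matrix.kronecker_mem_unitary hA hB) (evolution_mem_unitary hG s))

/-- Algebra homomorphisms commute with the exponential, so only the local unitaries need care.
Relabelling, local conjugation and adding ancillas are all instances. -/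
lemma Reach.map {G : Matrix (x × y) (x × y) ℂ}
    (f : Matrix (x × y) (x × y) ℂ →ₐ[ℂ] Matrix (x' × y') (x' × y') ℂ)
    (hf : ∀ A ∈ Matrix.unitaryGroup x ℂ, ∀ B ∈ Matrix.unitaryGroup y ℂ,
      ∃ A' ∈ Matrix.unitaryGroup x' ℂ, ∃ B' ∈ Matrix.unitaryGroup y' ℂ, f (A ⊗ₖ B) = A' ⊗ₖ B')
    {t : ℝ} {V : Matrix (x × y) (x × y) ℂ} (h : Reach G t V) : Reach (f G) t (f V) := by
  refine h.induction (p := fun t V => Reach (f G) t (f V)) ?_ ?_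
  · simpa using Reach.one (f G)
  · intro t V s A B hs hA hB _ hV
    obtain ⟨A', hA', B', hB', e⟩ := hf A hA B hB
    rw [map_mul, map_mul, e, evolution_map]
    exact (Reach.step (f G) hs hA' hB').mul hV

lemma kronecker_mulVec_mul (A : Matrix x x ℂ) (B : Matrix y y ℂ) (v : x → ℂ) (w : y → ℂ) :
    (A ⊗ₖ B).mulVec (fun p => v p.1 * w p.2) = fun p => A.mulVec v p.1 * B.mulVec w p.2 := by
  ext p
  simp only [Matrix.mulVec, dotProduct, Fintype.sum_prod_type, Finset.sum_mul_sum,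
    Matrix.kroneckerMap_apply]
  refine Finset.sum_congr rfl fun i _ => Finset.sum_congr rfl fun j _ => ?_
  ring

lemma submatrix_mem_unitary (e : x' ≃ x) {A : Matrix x x ℂ} (hA : A ∈ Matrix.unitaryGroup x ℂ) :
    A.submatrix e e ∈ Matrix.unitaryGroup x' ℂ := by
  rw [Matrix.mem_unitaryGroup_iff, Matrix.star_eq_conjTranspose, Matrix.conjTranspose_submatrix,
    Matrix.submatrix_mul_equiv, ← Matrix.star_eq_conjTranspose, Matrix.mem_unitaryGroup_iff.1 hA,
    Matrix.submatrix_one_equiv]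

lemma Reach.submatrix {G : Matrix (x × y) (x × y) ℂ} (e : x' ≃ x) (f : y' ≃ y) {t : ℝ}
    {V : Matrix (x × y) (x × y) ℂ} (h : Reach G t V) :
    Reach (G.submatrix (Prod.map e f) (Prod.map e f)) t
      (V.submatrix (Prod.map e f) (Prod.map e f)) := by
  refine h.map ((Matrix.reindexAlgEquiv ℂ ℂ (Equiv.prodCongr e f).symm).toAlgHom) ?_
  intro A hA B hB
  refine ⟨_, submatrix_mem_unitary e hA, _, submatrix_mem_unitary f hB, ?_⟩
  ext p q
  rfl

lemma Reach.conj {G : Matrix (x × y) (x × y) ℂ} {A : Matrix x x ℂ} {B : Matrix y y ℂ}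
    (hA : A ∈ Matrix.unitaryGroup x ℂ) (hB : B ∈ Matrix.unitaryGroup y ℂ) {t : ℝ}
    {V : Matrix (x × y) (x × y) ℂ} (h : Reach G t V) :
    Reach ((A ⊗ₖ B) * G * star (A ⊗ₖ B)) t ((A ⊗ₖ B) * V * star (A ⊗ₖ B)) := by
  have hU := Matrix.kronecker_mem_unitary hA hB
  let u : unitary (Matrix (x × y) (x × y) ℂ) := ⟨A ⊗ₖ B, hU⟩
  refine h.map (Unitary.conjStarAlgAut ℂ _ u).toStarAlgHom.toAlgHom ?_
  intro A' hA' B' hB'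
  refine ⟨A * A' * star A, mul_mem (mul_mem hA hA') (Unitary.star_mem hA),
    B * B' * star B, mul_mem (mul_mem hB hB') (Unitary.star_mem hB), ?_⟩
  change (A ⊗ₖ B) * (A' ⊗ₖ B') * star (A ⊗ₖ B) = _
  rw [Matrix.star_eq_conjTranspose, Matrix.conjTranspose_kronecker, ← Matrix.mul_kronecker_mul,
    ← Matrix.mul_kronecker_mul]
  rfl

end Reachable

/-! ### Adjoining ancillas to a Hamiltonian. -/

noncomputable section Ancilla

variable {a b u v u' v' : Type*} [Fintype a] [DecidableEq a] [Fintype b] [DecidableEq b]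
  [Fintype u] [DecidableEq u] [Fintype v] [DecidableEq v]
  [Fintype u'] [DecidableEq u'] [Fintype v'] [DecidableEq v']

lemma withAncillas_apply (H : Matrix (a × b) (a × b) ℂ) (p q : (a × u) × (b × v)) :
    withAncillas u v H p q =
      H (p.1.1, p.2.1) (q.1.1, q.2.1) *
        ((1 : Matrix u u ℂ) p.1.2 q.1.2 * (1 : Matrix v v ℂ) p.2.2 q.2.2) := by
  rw [← Matrix.kroneckerMap_apply (· * ·) (1 : Matrix u u ℂ) (1 : Matrix v v ℂ)
    (p.1.2, p.2.2) (q.1.2, q.2.2), Matrix.one_kronecker_one]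
  rfl

variable (u v) in
/-- Adding ancillas, as an algebra homomorphism. -/
def ancillaHom : Matrix (a × b) (a × b) ℂ →ₐ[ℂ] Matrix ((a × u) × (b × v)) ((a × u) × (b × v)) ℂ :=
  AlgHom.ofLinearMap
    { toFun := withAncillas u v
      map_add' := fun M N => by ext; simp [withAncillas, add_mul]
      map_smul' := fun c M => by ext; simp [withAncillas, mul_assoc] }
    (by simp [withAncillas])
    (fun M N => by
      change withAncillas u v (M * N) = withAncillas u v M * withAncillas u v N
      rw [withAncillas, withAncillas, withAncillas, Matrix.submatrix_mul_equiv,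
        ← Matrix.mul_kronecker_mul, one_mul])

lemma ancillaHom_apply (H : Matrix (a × b) (a × b) ℂ) : ancillaHom u v H = withAncillas u v H := rfl

lemma evolution_withAncillas (H : Matrix (a × b) (a × b) ℂ) (t : ℝ) :
    evolution (withAncillas u v H) t = withAncillas u v (evolution H t) :=
  (evolution_map (ancillaHom u v) H t).symm

lemma withAncillas_isHermitian {H : Matrix (a × b) (a × b) ℂ} (hH : H.IsHermitian) :
    (withAncillas u v H).IsHermitian := by
  rw [Matrix.IsHermitian, withAncillas, Matrix.conjTranspose_submatrix,
    Matrix.conjTranspose_kronecker, hH.eq, Matrix.conjTranspose_one]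

lemma withAncillas_star (H : Matrix (a × b) (a × b) ℂ) :
    star (withAncillas u v H) = withAncillas u v (star H) := by
  rw [Matrix.star_eq_conjTranspose, Matrix.star_eq_conjTranspose, withAncillas, withAncillas,
    Matrix.conjTranspose_submatrix, Matrix.conjTranspose_kronecker H, Matrix.conjTranspose_one]

lemma withAncillas_kronecker (A : Matrix a a ℂ) (B : Matrix b b ℂ) :
    withAncillas u v (A ⊗ₖ B) = (A ⊗ₖ (1 : Matrix u u ℂ)) ⊗ₖ (B ⊗ₖ (1 : Matrix v v ℂ)) := by
  ext p q
  rw [withAncillas_apply]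
  simp only [Matrix.kroneckerMap_apply]
  ring

lemma withAncillas_mulVec (H : Matrix (a × b) (a × b) ℂ) (w : (a × u) × (b × v) → ℂ)
    (p : (a × u) × (b × v)) :
    (withAncillas u v H).mulVec w p =
      H.mulVec (fun q => w ((q.1, p.1.2), (q.2, p.2.2))) (p.1.1, p.2.1) := by
  simp only [Matrix.mulVec, dotProduct, withAncillas_apply, Matrix.one_apply, Fintype.sum_prod_type]
  refine Finset.sum_congr rfl fun i _ => ?_
  rw [Finset.sum_comm]
  refine Finset.sum_congr rfl fun j _ => ?_
  rw [Finset.sum_comm]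
  simp

lemma l2norm_slices (w : (a × u) × (b × v) → ℂ) :
    l2norm w = l2norm (fun q : (a × b) × (u × v) => w ((q.1.1, q.2.1), (q.1.2, q.2.2))) :=
  (l2norm_comp_equiv (Equiv.prodProdProdComm a b u v) w).symm

lemma OpBound.withAncillas {H : Matrix (a × b) (a × b) ℂ} {C : ℝ} (h : OpBound H C) :
    OpBound (withAncillas u v H) C := by
  refine ⟨h.1, fun w => ?_⟩
  rw [l2norm_slices, l2norm_slices w]
  refine l2norm_le_of_slices h.1 fun z => ?_
  simp only [withAncillas_mulVec]
  exact h.2 _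

lemma Reach.withAncillas {G : Matrix (a × b) (a × b) ℂ} {t : ℝ} {V : Matrix (a × b) (a × b) ℂ}
    (h : Reach G t V) : Reach (withAncillas u v G) t (withAncillas u v V) := by
  refine h.map (ancillaHom u v) ?_
  intro A hA B hB
  exact ⟨_, Matrix.kronecker_mem_unitary hA (one_mem _), _,
    Matrix.kronecker_mem_unitary hB (one_mem _), withAncillas_kronecker A B⟩

lemma withAncillas_submatrix (H : Matrix (a × b) (a × b) ℂ) (e : u' ≃ u) (f : v' ≃ v) :
    (withAncillas u v H).submatrix
        (Prod.map (Equiv.prodCongr (.refl a) e) (Equiv.prodCongr (.refl b) f))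
        (Prod.map (Equiv.prodCongr (.refl a) e) (Equiv.prodCongr (.refl b) f)) =
      withAncillas u' v' H := by
  ext p q
  simp [withAncillas_apply, Matrix.one_apply]

end Ancilla

/-! ### Separating the register from the other systems. -/

noncomputable section Joint

variable {a b a' b' m n m' n' : Type*} [Fintype a] [DecidableEq a] [Fintype b] [DecidableEq b]
  [Fintype a'] [DecidableEq a'] [Fintype b'] [DecidableEq b']
  [Fintype m] [DecidableEq m] [Fintype n] [DecidableEq n]
  [Fintype m'] [DecidableEq m'] [Fintype n'] [DecidableEq n']

/-- Separates the register from all the other systems. -/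
def registerEquiv (a b a' b' m n : Type*) :
    (a × (a' × m)) × (b × (b' × n)) ≃ (a' × b') × ((a × m) × (b × n)) where
  toFun p := ((p.1.2.1, p.2.2.1), ((p.1.1, p.1.2.2), (p.2.1, p.2.2.2)))
  invFun q := ((q.2.1.1, (q.1.1, q.2.1.2)), (q.2.2.1, (q.1.2, q.2.2.2)))
  left_inv _ := rfl
  right_inv _ := rfl

/-- The operator `M` on the register together with `K` on all the other systems. -/
def jointOp (M : Matrix (a' × b') (a' × b') ℂ)
    (K : Matrix ((a × m) × (b × n)) ((a × m) × (b × n)) ℂ) :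
    Matrix ((a × (a' × m)) × (b × (b' × n))) ((a × (a' × m)) × (b × (b' × n))) ℂ :=
  (M ⊗ₖ K).submatrix (registerEquiv a b a' b' m n) (registerEquiv a b a' b' m n)

lemma jointOp_mulVec (M : Matrix (a' × b') (a' × b') ℂ)
    (K : Matrix ((a × m) × (b × n)) ((a × m) × (b × n)) ℂ) (ψ : a' × b' → ℂ)
    (χ : (a × m) × (b × n) → ℂ) :
    (jointOp M K).mulVec (jointState ψ χ) = jointState (M.mulVec ψ) (K.mulVec χ) := by
  have : (jointState ψ χ : (a × (a' × m)) × (b × (b' × n)) → ℂ) ∘ (registerEquiv a b a' b' m n).symm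
      = fun q => ψ q.1 * χ q.2 := rfl
  rw [jointOp, Matrix.submatrix_mulVec_equiv, this]
  ext p
  simp only [Function.comp_apply, Matrix.mulVec, dotProduct, jointState, Fintype.sum_prod_type (α₁ := a' × b'),
    Finset.sum_mul_sum, Matrix.kroneckerMap_apply]
  refine Finset.sum_congr rfl fun i _ => Finset.sum_congr rfl fun j _ => ?_
  simp only [registerEquiv, Equiv.coe_fn_mk]
  ring

lemma jointOp_mul (M M' : Matrix (a' × b') (a' × b') ℂ)
    (K K' : Matrix ((a × m) × (b × n)) ((a × m) × (b × n)) ℂ) :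
    jointOp M K * jointOp M' K' = jointOp (M * M') (K * K') := by
  rw [jointOp, jointOp, jointOp, Matrix.submatrix_mul_equiv, Matrix.mul_kronecker_mul]

lemma jointOp_star (M : Matrix (a' × b') (a' × b') ℂ)
    (K : Matrix ((a × m) × (b × n)) ((a × m) × (b × n)) ℂ) :
    star (jointOp M K) = jointOp (star M) (star K) := by
  simp only [jointOp, Matrix.star_eq_conjTranspose, Matrix.conjTranspose_submatrix,
    Matrix.conjTranspose_kronecker]

lemma withAncillas_eq_jointOp (H : Matrix (a × b) (a × b) ℂ) :
    withAncillas (a' × m) (b' × n) H = jointOp 1 (withAncillas m n H) := by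
  ext p q
  simp only [jointOp, withAncillas_apply, Matrix.submatrix_apply, Matrix.kroneckerMap_apply,
    registerEquiv, Equiv.coe_fn_mk, Matrix.one_apply, Prod.ext_iff]
  split_ifs <;> simp_all

lemma kronecker_eq_jointOp (A : Matrix a a ℂ) (A' : Matrix a' a' ℂ) (X : Matrix m m ℂ)
    (B : Matrix b b ℂ) (B' : Matrix b' b' ℂ) (Y : Matrix n n ℂ) :
    (A ⊗ₖ (A' ⊗ₖ X)) ⊗ₖ (B ⊗ₖ (B' ⊗ₖ Y)) = jointOp (A' ⊗ₖ B') ((A ⊗ₖ X) ⊗ₖ (B ⊗ₖ Y)) := by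
  ext p q
  simp only [jointOp, Matrix.submatrix_apply, Matrix.kroneckerMap_apply, registerEquiv,
    Equiv.coe_fn_mk]
  ring

lemma l2norm_jointState (ψ : a' × b' → ℂ) (χ : (a × m) × (b × n) → ℂ) :
    l2norm (jointState ψ χ) = l2norm ψ * l2norm χ := by
  rw [← l2norm_mul]
  exact l2norm_comp_equiv (registerEquiv a b a' b' m n) (fun q => ψ q.1 * χ q.2)

lemma jointState_sub_left (ψ φ : a' × b' → ℂ) (χ : (a × m) × (b × n) → ℂ) :
    jointState (ψ - φ) χ = jointState ψ χ - jointState φ χ := by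
  ext p; simp [jointState, sub_mul]

lemma jointState_smul_left (c : ℂ) (ψ : a' × b' → ℂ) (χ : (a × m) × (b × n) → ℂ) :
    jointState (c • ψ) χ = c • jointState ψ χ := by
  ext p; simp [jointState, mul_assoc]

end Joint

section SeqProd

/-- The product `V (k - 1) * ⋯ * V 0`. -/
def seqProd {M : Type*} [Monoid M] (V : ℕ → M) : ℕ → M
  | 0 => 1
  | k + 1 => V k * seqProd V k

lemma seqProd_map {M N : Type*} [Monoid M] [Monoid N] (f : M → N) (h1 : f 1 = 1)
    (hmul : ∀ x y, f (x * y) = f x * f y) (V : ℕ → M) (k : ℕ) :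
    seqProd (fun i => f (V i)) k = f (seqProd V k) := by
  induction k with
  | zero => exact h1.symm
  | succ k ih => rw [seqProd, seqProd, hmul, ih]

lemma seqProd_congr {M : Type*} [Monoid M] {V W : ℕ → M} {k : ℕ} (h : ∀ i < k, V i = W i) :
    seqProd V k = seqProd W k := by
  induction k with
  | zero => rfl
  | succ k ih => rw [seqProd, seqProd, h k k.lt_succ_self, ih fun i hi => h i (hi.trans k.lt_succ_self)]

lemma seqProd_submatrix {x x' : Type*} [Fintype x] [DecidableEq x] [Fintype x'] [DecidableEq x']
    (P : x' ≃ x) (V : ℕ → Matrix x x ℂ) (k : ℕ) :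
    seqProd (fun i => (V i).submatrix P P) k = (seqProd V k).submatrix P P :=
  seqProd_map (fun M : Matrix x x ℂ => M.submatrix P P) (Matrix.submatrix_one_equiv P)
    (fun M N => (Matrix.submatrix_mul_equiv M N P P P).symm) V k

end SeqProd

/-! ### Simulations as sequences of reachable unitaries. -/

noncomputable section Sim

variable {a b a' b' m n m' n' : Type*} [Fintype a] [DecidableEq a] [Fintype b] [DecidableEq b]
  [Fintype a'] [DecidableEq a'] [Fintype b'] [DecidableEq b']
  [Fintype m] [DecidableEq m] [Fintype n] [DecidableEq n]
  [Fintype m'] [DecidableEq m'] [Fintype n'] [DecidableEq n']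

variable (m n) in
/-- A simulation of `N` blocks of duration `τ` with accuracy `ε`, each block using `H` for the time
`t`, with ancillas `m` and `n`. -/
def SimData (H : Matrix (a × b) (a × b) ℂ) (H' : Matrix (a' × b') (a' × b') ℂ) (τ t : ℝ) (N : ℕ)
    (ε : ℝ) : Prop :=
  ∃ (α : a × m → ℂ) (β : b × n → ℂ)
    (V : ℕ → Matrix ((a × (a' × m)) × (b × (b' × n))) ((a × (a' × m)) × (b × (b' × n))) ℂ),
    l2norm α = 1 ∧ l2norm β = 1 ∧
    (∀ k, k < N → Reach (withAncillas (a' × m) (b' × n) H) t (V k)) ∧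
    ∀ k, k ≤ N → ∃ χ : (a × m) × (b × n) → ℂ, l2norm χ = 1 ∧
      ∀ ψ : a' × b' → ℂ, l2norm ψ = 1 →
        l2norm ((seqProd V k).mulVec (jointState ψ (fun q => α q.1 * β q.2))
          - jointState ((evolution H' (k * τ)).mulVec ψ) χ) ≤ ε

lemma runOp_range_flatMap {x y : Type*} [Fintype x] [DecidableEq x] [Fintype y] [DecidableEq y]
    (G : Matrix (x × y) (x × y) ℂ) (block : ℕ → List (Step x y)) (k : ℕ) :
    runOp G ((List.range k).flatMap block) = seqProd (fun i => runOp G (block i)) k := by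
  induction k with
  | zero => rfl
  | succ k ih => simp [List.range_succ, runOp_append, ih, seqProd]

lemma simulates_iff (H : Matrix (a × b) (a × b) ℂ) (H' : Matrix (a' × b') (a' × b') ℂ) (r : ℝ) :
    Simulates H H' r ↔ 0 < r ∧ ∀ (τ : ℝ) (N : ℕ) (ε : ℝ), 0 < τ → 0 < ε →
      ∃ m n : ℕ, SimData (Fin m) (Fin n) H H' τ (τ / r) N ε := by
  refine and_congr_right fun hr => forall_congr' fun τ => forall_congr' fun N =>
    forall_congr' fun ε => imp_congr_right fun hτ => imp_congr_right fun hε =>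
    exists_congr fun m => exists_congr fun n => ?_
  constructor
  · rintro ⟨α, β, block, hα, hβ, ht, h⟩
    refine ⟨α, β, fun k => runOp _ (block k), hα, hβ, fun k hk => ⟨block k, ht k hk, rfl⟩, ?_⟩
    intro k hk
    obtain ⟨χ, hχ, h⟩ := h k hk
    refine ⟨χ, hχ, fun ψ hψ => ?_⟩
    rw [← runOp_range_flatMap]
    exact h ψ hψ
  · rintro ⟨α, β, V, hα, hβ, hV, h⟩
    choose block hb using hV
    refine ⟨α, β, fun k => if hk : k < N then block k hk else [], hα, hβ, ?_, ?_⟩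
    · intro k hk
      simpa [hk] using (hb k hk).1
    · intro k hk
      obtain ⟨χ, hχ, h⟩ := h k hk
      refine ⟨χ, hχ, fun ψ hψ => ?_⟩
      rw [runOp_range_flatMap, seqProd_congr (W := V)]
      · exact h ψ hψ
      · intro i hi
        have hi' : i < N := hi.trans_le hk
        simpa [hi'] using (hb i hi').2

lemma SimData.reindex {H : Matrix (a × b) (a × b) ℂ} {H' : Matrix (a' × b') (a' × b') ℂ}
    {τ t ε : ℝ} {N : ℕ} (e : m' ≃ m) (f : n' ≃ n) (h : SimData m n H H' τ t N ε) :
    SimData m' n' H H' τ t N ε := by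
  obtain ⟨α, β, V, hα, hβ, hV, h⟩ := h
  let E : a × (a' × m') ≃ a × (a' × m) := Equiv.prodCongr (.refl a) (Equiv.prodCongr (.refl a') e)
  let F : b × (b' × n') ≃ b × (b' × n) := Equiv.prodCongr (.refl b) (Equiv.prodCongr (.refl b') f)
  let P := Equiv.prodCongr E F
  have key : ∀ (ψ : a' × b' → ℂ) (χ : (a × m) × (b × n) → ℂ),
      jointState ψ (fun q : (a × m') × (b × n') => χ ((q.1.1, e q.1.2), (q.2.1, f q.2.2))) =
        fun p => (jointState ψ χ) (P p) := fun ψ χ => rfl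
  refine ⟨fun q => α (q.1, e q.2), fun q => β (q.1, f q.2), fun k => (V k).submatrix P P,
    ?_, ?_, ?_, ?_⟩
  · exact (l2norm_comp_equiv (Equiv.prodCongr (.refl a) e) α).trans hα
  · exact (l2norm_comp_equiv (Equiv.prodCongr (.refl b) f) β).trans hβ
  · intro k hk
    have := (hV k hk).submatrix E F
    rwa [withAncillas_submatrix H (Equiv.prodCongr (.refl a') e) (Equiv.prodCongr (.refl b') f)]
      at this
  · intro k hk
    obtain ⟨χ, hχ, h⟩ := h k hk
    refine ⟨fun q => χ ((q.1.1, e q.1.2), (q.2.1, f q.2.2)), ?_, fun ψ hψ => ?_⟩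
    · exact (l2norm_comp_equiv (Equiv.prodCongr (Equiv.prodCongr (.refl a) e)
        (Equiv.prodCongr (.refl b) f)) χ).trans hχ
    · rw [seqProd_submatrix, key ψ (fun q => α q.1 * β q.2), key, Matrix.submatrix_mulVec_equiv]
      have e1 : (fun p => jointState ψ (fun q : (a × m) × (b × n) => α q.1 * β q.2) (P p)) ∘ P.symm
          = jointState ψ (fun q : (a × m) × (b × n) => α q.1 * β q.2) := by
        ext p; simp
      rw [e1]
      refine le_of_eq_of_le ?_ (h ψ hψ)
      clear_value P
      exact l2norm_comp_equiv P (_ - _)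

/-- Constructions produce ancillas indexed by products of types; only their cardinality matters. -/
lemma SimData.exists_fin {H : Matrix (a × b) (a × b) ℂ} {H' : Matrix (a' × b') (a' × b') ℂ}
    {τ t ε : ℝ} {N : ℕ} (h : SimData m n H H' τ t N ε) :
    ∃ m' n' : ℕ, SimData (Fin m') (Fin n') H H' τ t N ε :=
  ⟨_, _, h.reindex (Fintype.equivFin m).symm (Fintype.equivFin n).symm⟩

/-- Every block is conjugated by a product unitary `W` that rotates both the system and the
register. The initial state of the system is rotated as well, so that the `W` factors meet the
original simulation run on the back-rotated input. -/
lemma SimData.conj {H : Matrix (a × b) (a × b) ℂ} {H' : Matrix (a' × b') (a' × b') ℂ}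
    {τ t ε : ℝ} {N : ℕ} (h : SimData m n H H' τ t N ε)
    {A : Matrix a a ℂ} {B : Matrix b b ℂ} {A' : Matrix a' a' ℂ} {B' : Matrix b' b' ℂ}
    (hA : A ∈ Matrix.unitaryGroup a ℂ) (hB : B ∈ Matrix.unitaryGroup b ℂ)
    (hA' : A' ∈ Matrix.unitaryGroup a' ℂ) (hB' : B' ∈ Matrix.unitaryGroup b' ℂ) :
    SimData m n ((A ⊗ₖ B) * H * star (A ⊗ₖ B)) ((A' ⊗ₖ B') * H' * star (A' ⊗ₖ B')) τ t N ε := by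
  obtain ⟨α, β, V, hα, hβ, hV, h⟩ := h
  have hAm := Matrix.kronecker_mem_unitary hA (one_mem (Matrix.unitaryGroup m ℂ))
  have hBn := Matrix.kronecker_mem_unitary hB (one_mem (Matrix.unitaryGroup n ℂ))
  have hK := Matrix.kronecker_mem_unitary hAm hBn
  have hM := Matrix.kronecker_mem_unitary hA' hB'
  have hX := Matrix.kronecker_mem_unitary hA (Matrix.kronecker_mem_unitary hA'
    (one_mem (Matrix.unitaryGroup m ℂ)))
  have hY := Matrix.kronecker_mem_unitary hB (Matrix.kronecker_mem_unitary hB'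
    (one_mem (Matrix.unitaryGroup n ℂ)))
  have hW := Matrix.kronecker_mem_unitary hX hY
  set W := (A ⊗ₖ (A' ⊗ₖ (1 : Matrix m m ℂ))) ⊗ₖ (B ⊗ₖ (B' ⊗ₖ (1 : Matrix n n ℂ))) with hWdef
  set K := (A ⊗ₖ (1 : Matrix m m ℂ)) ⊗ₖ (B ⊗ₖ (1 : Matrix n n ℂ)) with hKdef
  have hWj : W = jointOp (A' ⊗ₖ B') K := kronecker_eq_jointOp ..
  have hprod : (fun q : (a × m) × (b × n) =>
      (A ⊗ₖ (1 : Matrix m m ℂ)).mulVec α q.1 * (B ⊗ₖ (1 : Matrix n n ℂ)).mulVec β q.2) =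
      K.mulVec (fun q => α q.1 * β q.2) := (kronecker_mulVec_mul _ _ _ _).symm
  refine ⟨(A ⊗ₖ (1 : Matrix m m ℂ)).mulVec α, (B ⊗ₖ (1 : Matrix n n ℂ)).mulVec β,
    fun k => W * V k * star W, ?_, ?_, ?_, ?_⟩
  · rw [l2norm_mulVec_unitary hAm, hα]
  · rw [l2norm_mulVec_unitary hBn, hβ]
  · intro k hk
    have := (hV k hk).conj hX hY
    rw [← hWdef] at this
    convert this using 1
    rw [hWj, jointOp_star, withAncillas_eq_jointOp, withAncillas_eq_jointOp, jointOp_mul,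
      jointOp_mul, mul_one, Matrix.mem_unitaryGroup_iff.1 hM, ← ancillaHom_apply, map_mul, map_mul,
      ancillaHom_apply, ancillaHom_apply, ancillaHom_apply, withAncillas_kronecker, ← hKdef]
    rw [hKdef, ← withAncillas_kronecker, withAncillas_star]
  · intro k hk
    obtain ⟨χ, hχ, h⟩ := h k hk
    refine ⟨K.mulVec χ, by rw [l2norm_mulVec_unitary hK, hχ], fun ψ hψ => ?_⟩
    have hψ' : l2norm ((star (A' ⊗ₖ B')).mulVec ψ) = 1 := by
      rw [l2norm_mulVec_unitary (Unitary.star_mem hM), hψ]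
    rw [seqProd_map (fun M => W * M * star W) (by
        rw [mul_one]; exact Matrix.mem_unitaryGroup_iff.1 hW) (fun M N => by
        calc W * (M * N) * star W = W * M * 1 * N * star W := by simp only [mul_assoc, mul_one]
          _ = W * M * (star W * W) * N * star W := by rw [Matrix.mem_unitaryGroup_iff'.1 hW]
          _ = _ := by simp only [mul_assoc]), hprod, evolution_conj hM]
    have e1 : (W * seqProd V k * star W).mulVec
        (jointState ψ (K.mulVec fun q => α q.1 * β q.2)) =
        W.mulVec ((seqProd V k).mulVec
          (jointState ((star (A' ⊗ₖ B')).mulVec ψ) fun q => α q.1 * β q.2)) := by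
      rw [← Matrix.mulVec_mulVec, ← Matrix.mulVec_mulVec, hWj, jointOp_star, jointOp_mulVec,
        Matrix.mulVec_mulVec (M := star K), Matrix.mem_unitaryGroup_iff'.1 hK, Matrix.one_mulVec]
    have e2 : jointState (((A' ⊗ₖ B') * evolution H' (k * τ) * star (A' ⊗ₖ B')).mulVec ψ)
        (K.mulVec χ) = W.mulVec (jointState
          ((evolution H' (k * τ)).mulVec ((star (A' ⊗ₖ B')).mulVec ψ)) χ) := by
      rw [hWj, jointOp_mulVec, Matrix.mulVec_mulVec, Matrix.mulVec_mulVec]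
    rw [e1, e2, ← Matrix.mulVec_sub, l2norm_mulVec_unitary hW]
    exact h _ hψ'

lemma Simulates.conj {H : Matrix (a × b) (a × b) ℂ} {H' : Matrix (a' × b') (a' × b') ℂ} {r : ℝ}
    (h : Simulates H H' r)
    {A : Matrix a a ℂ} {B : Matrix b b ℂ} {A' : Matrix a' a' ℂ} {B' : Matrix b' b' ℂ}
    (hA : A ∈ Matrix.unitaryGroup a ℂ) (hB : B ∈ Matrix.unitaryGroup b ℂ)
    (hA' : A' ∈ Matrix.unitaryGroup a' ℂ) (hB' : B' ∈ Matrix.unitaryGroup b' ℂ) :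
    Simulates ((A ⊗ₖ B) * H * star (A ⊗ₖ B)) ((A' ⊗ₖ B') * H' * star (A' ⊗ₖ B')) r := by
  rw [simulates_iff] at h ⊢
  refine ⟨h.1, fun τ N ε hτ hε => ?_⟩
  obtain ⟨m, n, h⟩ := h.2 τ N ε hτ hε
  exact ⟨m, n, h.conj hA hB hA' hB'⟩

/-- One error-free block is repeated. The other systems may drift from `χ k` to `χ (k + 1)`, which
matters when the given Hamiltonian runs without being used. -/
lemma Simulates.of_exact {H : Matrix (a × b) (a × b) ℂ} {H' : Matrix (a' × b') (a' × b') ℂ} {r : ℝ}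
    (hr : 0 < r) (α : a × m → ℂ) (β : b × n → ℂ) (hα : l2norm α = 1) (hβ : l2norm β = 1)
    (h : ∀ τ : ℝ, 0 < τ → ∃ χ : ℕ → (a × m) × (b × n) → ℂ, χ 0 = (fun q => α q.1 * β q.2) ∧
      (∀ k, l2norm (χ k) = 1) ∧
      ∃ V, Reach (withAncillas (a' × m) (b' × n) H) (τ / r) V ∧
        ∀ k ψ, V.mulVec (jointState ψ (χ k)) =
          jointState ((evolution H' τ).mulVec ψ) (χ (k + 1))) :
    Simulates H H' r := by
  rw [simulates_iff]
  refine ⟨hr, fun τ N ε hτ hε => SimData.exists_fin (m := m) (n := n) ?_⟩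
  obtain ⟨χ, hχ0, hχ, V, hV, h⟩ := h τ hτ
  refine ⟨α, β, fun _ => V, hα, hβ, fun _ _ => hV, fun k _ => ⟨χ k, hχ k, fun ψ _ => ?_⟩⟩
  rw [← hχ0]
  have key : ∀ k : ℕ, (seqProd (fun _ => V) k).mulVec (jointState ψ (χ 0)) =
      jointState ((evolution H' (k * τ)).mulVec ψ) (χ k) := by
    intro k
    induction k with
    | zero => simp [seqProd, evolution_zero_time]
    | succ k ih =>
      rw [seqProd, ← Matrix.mulVec_mulVec, ih, h, Matrix.mulVec_mulVec, ← evolution_add]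
      congr 3
      push_cast
      ring
  rw [key, sub_self, l2norm_zero]
  exact hε.le

end Sim

/-! ### Exact simulation between diagonal Hamiltonians. -/

noncomputable section Exact

variable {a b a' b' m n u v : Type*} [Fintype a] [DecidableEq a] [Fintype b] [DecidableEq b]
  [Fintype a'] [DecidableEq a'] [Fintype b'] [DecidableEq b']
  [Fintype m] [DecidableEq m] [Fintype n] [DecidableEq n]
  [Fintype u] [DecidableEq u] [Fintype v] [DecidableEq v]

variable (b) in
/-- `A ↦ A ⊗ 1` as an algebra homomorphism. -/
def kroneckerOneHom : Matrix a a ℂ →ₐ[ℂ] Matrix (a × b) (a × b) ℂ :=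
  AlgHom.ofLinearMap
    { toFun := fun A => A ⊗ₖ (1 : Matrix b b ℂ)
      map_add' := fun M N => Matrix.add_kronecker M N 1
      map_smul' := fun c M => Matrix.smul_kronecker c M 1 }
    Matrix.one_kronecker_one
    (fun M N => by
      change (M * N) ⊗ₖ (1 : Matrix b b ℂ) = M ⊗ₖ (1 : Matrix b b ℂ) * N ⊗ₖ (1 : Matrix b b ℂ)
      rw [← Matrix.mul_kronecker_mul, one_mul])

variable (a) in
/-- `B ↦ 1 ⊗ B` as an algebra homomorphism. -/
def oneKroneckerHom : Matrix b b ℂ →ₐ[ℂ] Matrix (a × b) (a × b) ℂ :=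
  AlgHom.ofLinearMap
    { toFun := fun B => (1 : Matrix a a ℂ) ⊗ₖ B
      map_add' := fun M N => Matrix.kronecker_add 1 M N
      map_smul' := fun c M => Matrix.kronecker_smul c 1 M }
    Matrix.one_kronecker_one
    (fun M N => by
      change (1 : Matrix a a ℂ) ⊗ₖ (M * N) = (1 : Matrix a a ℂ) ⊗ₖ M * (1 : Matrix a a ℂ) ⊗ₖ N
      rw [← Matrix.mul_kronecker_mul, one_mul])

lemma evolution_local (A : Matrix a a ℂ) (B : Matrix b b ℂ) (t : ℝ) :
    evolution (A ⊗ₖ (1 : Matrix b b ℂ) + (1 : Matrix a a ℂ) ⊗ₖ B) t =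
      evolution A t ⊗ₖ evolution B t := by
  rw [evolution_add_of_commute]
  · have h1 := evolution_map (kroneckerOneHom b) A t
    have h2 := evolution_map (oneKroneckerHom a) B t
    change evolution A t ⊗ₖ (1 : Matrix b b ℂ) = evolution (A ⊗ₖ (1 : Matrix b b ℂ)) t at h1
    change (1 : Matrix a a ℂ) ⊗ₖ evolution B t = evolution ((1 : Matrix a a ℂ) ⊗ₖ B) t at h2
    rw [← h1, ← h2, ← Matrix.mul_kronecker_mul, mul_one, one_mul]
  · rw [Commute, SemiconjBy, ← Matrix.mul_kronecker_mul, ← Matrix.mul_kronecker_mul, mul_one,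
      one_mul, mul_one, one_mul]

/-- The vector of a system with a trivial ancilla that is in the basis state `k`. -/
def basisState (k : a) : a × Fin 1 → ℂ := fun q => if q.1 = k then 1 else 0

lemma l2norm_basisState (k : a) : l2norm (basisState k) = 1 := by
  rw [← sq_eq_sq₀ (l2norm_nonneg _) zero_le_one, l2norm_sq, Fintype.sum_prod_type]
  simp [basisState, apply_ite, ite_pow]

/-- `H` runs idly on its own system while local unitaries on the register perform the product
evolution. The time spent on `H` is irrelevant, so every positive rate occurs. -/
lemma simulates_of_isLocal [Nonempty a] [Nonempty b] {H : Matrix (a × b) (a × b) ℂ}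
    {H' : Matrix (a' × b') (a' × b') ℂ} (hH : H.IsHermitian) (hH' : IsLocalHamiltonian H') {r : ℝ}
    (hr : 0 < r) : Simulates H H' r := by
  obtain ⟨A, B, hA, hB, rfl⟩ := hH'
  obtain ⟨k⟩ := ‹Nonempty a›
  obtain ⟨l⟩ := ‹Nonempty b›
  refine Simulates.of_exact (m := Fin 1) (n := Fin 1) hr (basisState k) (basisState l)
    (l2norm_basisState k) (l2norm_basisState l) fun τ hτ => ?_
  let E : Matrix ((a × Fin 1) × (b × Fin 1)) ((a × Fin 1) × (b × Fin 1)) ℂ :=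
    withAncillas (Fin 1) (Fin 1) (evolution H (τ / r))
  have hE : E ∈ Matrix.unitaryGroup _ ℂ := by
    change withAncillas (Fin 1) (Fin 1) (evolution H (τ / r)) ∈ _
    rw [← evolution_withAncillas]
    exact evolution_mem_unitary (withAncillas_isHermitian hH) _
  refine ⟨fun i => (E ^ i).mulVec fun q => basisState k q.1 * basisState l q.2, by simp,
    fun i => ?_, _, Reach.step _ (div_nonneg hτ.le hr.le)
      (Matrix.kronecker_mem_unitary (one_mem _)
        (Matrix.kronecker_mem_unitary (evolution_mem_unitary hA τ) (one_mem _)))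
      (Matrix.kronecker_mem_unitary (one_mem _)
        (Matrix.kronecker_mem_unitary (evolution_mem_unitary hB τ) (one_mem _))), fun i ψ => ?_⟩
  · rw [l2norm_mulVec_unitary (pow_mem hE i), l2norm_mul, l2norm_basisState, l2norm_basisState,
      one_mul]
  · rw [kronecker_eq_jointOp, evolution_withAncillas, withAncillas_eq_jointOp, jointOp_mul,
      jointOp_mulVec, Matrix.one_kronecker_one, Matrix.one_kronecker_one,
      Matrix.one_kronecker_one, one_mul, mul_one, evolution_local, Matrix.mulVec_mulVec]
    change _ = jointState _ ((E ^ (i + 1)).mulVec _)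
    rw [pow_succ']

/-- The Hamiltonian that is diagonal in the standard basis with the eigenvalues `e k l`. -/
def diagHam (e : a → b → ℝ) : Matrix (a × b) (a × b) ℂ :=
  Matrix.diagonal fun p => ((e p.1 p.2 : ℝ) : ℂ)

lemma diagHam_isHermitian (e : a → b → ℝ) : (diagHam e).IsHermitian := by
  rw [diagHam, Matrix.isHermitian_diagonal_iff]
  intro p
  simp [IsSelfAdjoint]

lemma evolution_diagHam_mulVec (e : a → b → ℝ) (t : ℝ) (ψ : a × b → ℂ) :
    (evolution (diagHam e) t).mulVec ψ =
      fun p => Complex.exp (-(Complex.I * ((t * e p.1 p.2 : ℝ) : ℂ))) * ψ p := by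
  ext p
  rw [diagHam, evolution_diagonal, Matrix.mulVec_diagonal]
  congr 2
  push_cast
  ring

lemma withAncillas_diagHam (e : a → b → ℝ) :
    withAncillas u v (diagHam e) = diagHam fun (p : a × u) (q : b × v) => e p.1 q.1 := by
  ext p q
  simp only [withAncillas_apply, diagHam, Matrix.diagonal_apply, Matrix.one_apply, Prod.ext_iff]
  split_ifs <;> simp_all

/-- The matrix that permutes the coordinates by `σ`. -/
def permMat (σ : a ≃ a) : Matrix a a ℂ := (1 : Matrix a a ℂ).submatrix σ id

lemma permMat_mem_unitary (σ : a ≃ a) : permMat σ ∈ Matrix.unitaryGroup a ℂ := by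
  rw [Matrix.mem_unitaryGroup_iff, Matrix.star_eq_conjTranspose, permMat,
    Matrix.conjTranspose_submatrix, Matrix.conjTranspose_one,
    ← Matrix.submatrix_mul _ _ _ _ _ Function.bijective_id, one_mul, Matrix.submatrix_one_equiv]

lemma permMat_kronecker_mulVec (σ : a ≃ a) (σ' : b ≃ b) (w : a × b → ℂ) :
    (permMat σ ⊗ₖ permMat σ').mulVec w = fun p => w (σ p.1, σ' p.2) := by
  have : permMat σ ⊗ₖ permMat σ' = permMat (Equiv.prodCongr σ σ') := by
    rw [permMat, permMat, permMat, ← Matrix.one_kronecker_one]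
    rfl
  rw [this]
  ext p
  simp only [permMat, Matrix.mulVec, dotProduct, Matrix.submatrix_apply, Matrix.one_apply, id,
    ite_mul, one_mul, zero_mul, Finset.sum_ite_eq, Finset.mem_univ, if_true]
  rfl

lemma diagonal_phase_mem_unitary (f : a → ℝ) :
    Matrix.diagonal (fun k => Complex.exp (-(Complex.I * (f k : ℂ)))) ∈
      Matrix.unitaryGroup a ℂ := by
  rw [Matrix.mem_unitaryGroup_iff, Matrix.star_eq_conjTranspose, Matrix.diagonal_conjTranspose,
    Matrix.diagonal_mul_diagonal, ← Matrix.diagonal_one]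
  congr 1
  ext k
  simp [← Complex.exp_conj, ← Complex.exp_add]

/-- With the Hamiltonian `diagHam e` used for the time `t`, the phases `exp (-i θ)` can be applied
to the register, the system being left in the product state `k₀`, `l₀`. -/
def PhaseReach (e : a → b → ℝ) (k₀ : a) (l₀ : b) (t : ℝ) (θ : a' → b' → ℝ) : Prop :=
  ∃ V, Reach (withAncillas (a' × Fin 1) (b' × Fin 1) (diagHam e)) t V ∧
    ∀ ψ : a' × b' → ℂ,
      V.mulVec (jointState ψ fun q => basisState k₀ q.1 * basisState l₀ q.2) =
        jointState (fun p => Complex.exp (-(Complex.I * (θ p.1 p.2 : ℂ))) * ψ p)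
          fun q => basisState k₀ q.1 * basisState l₀ q.2

lemma PhaseReach.add {e : a → b → ℝ} {k₀ : a} {l₀ : b} {s t : ℝ} {θ η : a' → b' → ℝ}
    (hθ : PhaseReach e k₀ l₀ s θ) (hη : PhaseReach e k₀ l₀ t η) :
    PhaseReach e k₀ l₀ (s + t) (θ + η) := by
  obtain ⟨V, hV, hV'⟩ := hθ
  obtain ⟨W, hW, hW'⟩ := hη
  refine ⟨W * V, hV.mul hW, fun ψ => ?_⟩
  rw [← Matrix.mulVec_mulVec, hV', hW']
  congr 1
  ext p
  rw [← mul_assoc, ← Complex.exp_add]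
  congr 2
  simp only [Pi.add_apply]
  push_cast
  ring

lemma PhaseReach.loc (e : a → b → ℝ) (k₀ : a) (l₀ : b) (f : a' → ℝ) (g : b' → ℝ) :
    PhaseReach e k₀ l₀ 0 (fun k l => f k + g l) := by
  refine ⟨_, Reach.loc _
    (Matrix.kronecker_mem_unitary (one_mem _)
      (Matrix.kronecker_mem_unitary (diagonal_phase_mem_unitary f) (one_mem _)))
    (Matrix.kronecker_mem_unitary (one_mem _)
      (Matrix.kronecker_mem_unitary (diagonal_phase_mem_unitary g) (one_mem _))), fun ψ => ?_⟩
  rw [kronecker_eq_jointOp, jointOp_mulVec, Matrix.one_kronecker_one, Matrix.one_kronecker_one,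
    Matrix.one_kronecker_one, Matrix.one_mulVec, Matrix.diagonal_kronecker_diagonal]
  congr 1
  ext p
  rw [Matrix.mulVec_diagonal, ← Complex.exp_add]
  congr 2
  push_cast
  ring

/-- Controlled on the register, each party swaps its starting level with the chosen one. The
evolution then gives the phase of the eigenvalue at `(κ k, μ l)`, and repeating the swaps, which are
involutions, restores `k₀` and `l₀`. -/
lemma PhaseReach.controlled (e : a → b → ℝ) (k₀ : a) (l₀ : b) {t : ℝ} (ht : 0 ≤ t) (κ : a' → a)
    (μ : b' → b) : PhaseReach e k₀ l₀ t (fun k l => t * e (κ k) (μ l)) := by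
  let σ : a × (a' × Fin 1) ≃ a × (a' × Fin 1) :=
    Function.Involutive.toPerm (fun p => (Equiv.swap k₀ (κ p.2.1) p.1, p.2)) fun p => by simp
  let σ' : b × (b' × Fin 1) ≃ b × (b' × Fin 1) :=
    Function.Involutive.toPerm (fun p => (Equiv.swap l₀ (μ p.2.1) p.1, p.2)) fun p => by simp
  have hP := Reach.loc (withAncillas (a' × Fin 1) (b' × Fin 1) (diagHam e))
    (permMat_mem_unitary σ) (permMat_mem_unitary σ')
  have hV := (hP.mul (Reach.evolution _ ht)).mul hP
  rw [zero_add, add_zero] at hV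
  refine ⟨_, hV, fun ψ => ?_⟩
  have h1 : ∀ p, σ (σ p) = p := fun p => by simp [σ, Function.Involutive.toPerm]
  have h2 : ∀ p, σ' (σ' p) = p := fun p => by simp [σ', Function.Involutive.toPerm]
  rw [← Matrix.mulVec_mulVec, ← Matrix.mulVec_mulVec, permMat_kronecker_mulVec,
    withAncillas_diagHam, evolution_diagHam_mulVec, permMat_kronecker_mulVec]
  ext ⟨⟨k, k', i⟩, ⟨l, l', j⟩⟩
  simp only [h1, h2, jointState, basisState]
  -- Away from the starting levels both sides vanish, because `basisState` does.
  by_cases hk : k = k₀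
  · by_cases hl : l = l₀
    · subst hk hl
      simp [σ, σ', Function.Involutive.toPerm]
    · simp [hl]
  · simp [hk]

variable (a b) in
/-- The matrices `x k * y l` with signs `x k`, `y l`. -/
def signProducts : Set (a → b → ℝ) :=
  {M | ∃ (x : a → ℝ) (y : b → ℝ), (∀ k, x k = 1 ∨ x k = -1) ∧ (∀ l, y l = 1 ∨ y l = -1) ∧
    M = fun k l => x k * y l}

/-- Up to local terms, the eigenvalues `e k l` are `c` times a convex combination of sign products,
which attains its extreme values at four corners. -/
def IsingLike (e : a → b → ℝ) (c : ℝ) : Prop :=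
  0 ≤ c ∧ ∃ (f : a → ℝ) (g : b → ℝ) (n : a → b → ℝ),
    (∀ k l, e k l = f k + g l + n k l) ∧
    (∃ m ∈ convexHull ℝ (signProducts a b), ∀ k l, n k l = c * m k l) ∧
    ∃ k₀ k₁ l₀ l₁, n k₀ l₀ = c ∧ n k₀ l₁ = -c ∧ n k₁ l₀ = -c ∧ n k₁ l₁ = c

/-- The matrices `m` that can be imprinted for every duration form a convex set, by splitting the
duration in proportion to the weights. Sign products belong to it: the signs select one of the four
corners, where `n` equals `c` times their product, and local phases undo `f` and `g`. -/
lemma phaseReach_of_mem_convexHull {e : a → b → ℝ} {c : ℝ} {f : a → ℝ} {g : b → ℝ}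
    {n : a → b → ℝ} (he : ∀ k l, e k l = f k + g l + n k l) {k₀ k₁ : a} {l₀ l₁ : b}
    (h₀₀ : n k₀ l₀ = c) (h₀₁ : n k₀ l₁ = -c) (h₁₀ : n k₁ l₀ = -c) (h₁₁ : n k₁ l₁ = c)
    {m : a' → b' → ℝ} (hm : m ∈ convexHull ℝ (signProducts a' b')) :
    ∀ s : ℝ, 0 ≤ s → PhaseReach e k₀ l₀ s (fun k l => s * (c * m k l)) := by
  let S : Set (a' → b' → ℝ) :=
    {m | ∀ s : ℝ, 0 ≤ s → PhaseReach e k₀ l₀ s (fun k l => s * (c * m k l))}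
  refine convexHull_min (t := S) ?_ ?_ hm
  · rintro _ ⟨x, y, hx, hy, rfl⟩ s hs
    let κ : a' → a := fun k => if x k = 1 then k₀ else k₁
    let μ : b' → b := fun l => if y l = 1 then l₀ else l₁
    have h := (PhaseReach.controlled e k₀ l₀ hs κ μ).add
      (PhaseReach.loc e k₀ l₀ (fun k => -(s * f (κ k))) (fun l => -(s * g (μ l))))
    rw [add_zero] at h
    convert h using 1
    ext k l
    have hn : n (κ k) (μ l) = c * (x k * y l) := by
      have : (-1 : ℝ) ≠ 1 := by norm_num
      rcases hx k with hx | hx <;> rcases hy l with hy | hy <;>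
        simp [κ, μ, hx, hy, this, h₀₀, h₀₁, h₁₀, h₁₁]
    simp only [Pi.add_apply, he, hn]
    ring
  · intro m₁ h₁ m₂ h₂ p q hp hq hpq s hs
    have h := (h₁ (s * p) (by positivity)).add (h₂ (s * q) (by positivity))
    rw [← mul_add, hpq, mul_one] at h
    convert h using 1
    ext k l
    simp only [Pi.add_apply, Pi.smul_apply, smul_eq_mul]
    ring

/-- The resource contributes only its corners and the target only its convex decomposition. Running
for `τ * c' / c` at strength `c` yields the phases `τ * c' * m`, the nonlocal part of the target. -/
lemma simulates_diagHam {e : a → b → ℝ} {e' : a' → b' → ℝ} {c c' : ℝ} (he : IsingLike e c)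
    (he' : IsingLike e' c') (hc : 0 < c) (hc' : 0 < c') :
    Simulates (diagHam e) (diagHam e') (c / c') := by
  obtain ⟨-, f, g, n, he, -, k₀, k₁, l₀, l₁, h₀₀, h₀₁, h₁₀, h₁₁⟩ := he
  obtain ⟨-, f', g', n', he', ⟨m, hm, hn'⟩, -⟩ := he'
  refine Simulates.of_exact (div_pos hc hc') (basisState k₀) (basisState l₀)
    (l2norm_basisState _) (l2norm_basisState _) fun τ hτ => ?_
  refine ⟨fun _ q => basisState k₀ q.1 * basisState l₀ q.2, rfl, fun _ => ?_, ?_⟩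
  · rw [l2norm_mul, l2norm_basisState, l2norm_basisState, one_mul]
  · obtain ⟨V, hV, h⟩ := (phaseReach_of_mem_convexHull he h₀₀ h₀₁ h₁₀ h₁₁ hm (τ / (c / c'))
      (by positivity)).add (PhaseReach.loc e k₀ l₀ (fun k => τ * f' k) (fun l => τ * g' l))
    rw [add_zero] at hV
    refine ⟨V, hV, fun _ ψ => ?_⟩
    rw [h, evolution_diagHam_mulVec]
    congr 1
    ext p
    congr 5
    simp only [Pi.add_apply, he', hn']
    field_simp
    ring

end Exact

/-! ### Cutting protocols into equal time slots. -/

noncomputable section Slots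

variable {x y : Type*} [Fintype x] [DecidableEq x] [Fintype y] [DecidableEq y]

/-- `W` can be performed with local unitaries and `n` evolutions under `G` of duration `δ`. -/
inductive ReachSlots (G : Matrix (x × y) (x × y) ℂ) (δ : ℝ) : ℕ → Matrix (x × y) (x × y) ℂ → Prop
  | loc {A : Matrix x x ℂ} {B : Matrix y y ℂ} (hA : A ∈ Matrix.unitaryGroup x ℂ)
      (hB : B ∈ Matrix.unitaryGroup y ℂ) : ReachSlots G δ 0 (A ⊗ₖ B)
  | slot : ReachSlots G δ 1 (evolution G δ)
  | mul {k l : ℕ} {V W : Matrix (x × y) (x × y) ℂ} (hV : ReachSlots G δ k V)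
      (hW : ReachSlots G δ l W) : ReachSlots G δ (k + l) (W * V)

lemma ReachSlots.one (G : Matrix (x × y) (x × y) ℂ) (δ : ℝ) : ReachSlots G δ 0 1 := by
  simpa using ReachSlots.loc (G := G) (δ := δ) (one_mem (Matrix.unitaryGroup x ℂ))
    (one_mem (Matrix.unitaryGroup y ℂ))

lemma ReachSlots.evolution (G : Matrix (x × y) (x × y) ℂ) (δ : ℝ) (n : ℕ) :
    ReachSlots G δ n (evolution G (n * δ)) := by
  induction n with
  | zero => simpa [evolution_zero_time] using ReachSlots.one G δ
  | succ n ih =>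
    have := ih.mul .slot
    rwa [← evolution_add, show δ + n * δ = ((n + 1 : ℕ) : ℝ) * δ by push_cast; ring] at this

/-- Rounding is done on a global time grid: an interval receives as many slots as the grid points it
passes. Each interval is then off by at most `δ`, while the slot counts of consecutive intervals
telescope. -/
lemma abs_sub_floor_mul_le {δ s t : ℝ} (hδ : 0 < δ) (hs : 0 ≤ s) (ht : 0 ≤ t) :
    |s - ((⌊(t + s) / δ⌋₊ - ⌊t / δ⌋₊ : ℕ) : ℝ) * δ| ≤ δ := by
  have hle : ⌊t / δ⌋₊ ≤ ⌊(t + s) / δ⌋₊ := Nat.floor_le_floor (by gcongr; linarith)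
  rw [Nat.cast_sub hle]
  have h1 := Nat.floor_le (show 0 ≤ t / δ by positivity)
  have h2 := Nat.lt_floor_add_one (t / δ)
  have h3 := Nat.floor_le (show 0 ≤ (t + s) / δ by positivity)
  have h4 := Nat.lt_floor_add_one ((t + s) / δ)
  rw [le_div_iff₀ hδ] at h1 h3
  rw [div_lt_iff₀ hδ] at h2 h4
  rw [abs_le]
  constructor <;> nlinarith

lemma l2norm_evolution_sub_le_abs {G : Matrix (x × y) (x × y) ℂ} (hG : G.IsHermitian) {C : ℝ}
    (hC : OpBound G C) (s t : ℝ) (v : x × y → ℂ) :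
    l2norm ((evolution G t).mulVec v - (evolution G s).mulVec v) ≤ |t - s| * C * l2norm v := by
  rcases le_total s t with h | h
  · rw [abs_of_nonneg (sub_nonneg.2 h)]
    exact l2norm_evolution_sub_le hG hC h v
  · rw [abs_sub_comm, abs_of_nonneg (sub_nonneg.2 h), l2norm_sub_comm]
    exact l2norm_evolution_sub_le hG hC h v

/-- `L` counts the steps of the protocol and does not depend on `δ`, so the error vanishes as `δ`
tends to zero. The starting time `t₀` is general because the induction removes an initial step; the
total number of slots depends only on `t₀`, `t` and `δ`. -/
lemma Reach.exists_slots {G : Matrix (x × y) (x × y) ℂ} (hG : G.IsHermitian) {C : ℝ}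
    (hC : OpBound G C) {t : ℝ} {V : Matrix (x × y) (x × y) ℂ} (h : Reach G t V) :
    ∃ L : ℕ, ∀ δ t₀ : ℝ, 0 < δ → 0 ≤ t₀ → ∃ W,
      ReachSlots G δ (⌊(t₀ + t) / δ⌋₊ - ⌊t₀ / δ⌋₊) W ∧
      ∀ v, l2norm (V.mulVec v - W.mulVec v) ≤ L * δ * C * l2norm v := by
  refine h.induction (p := fun t V => ∃ L : ℕ, ∀ δ t₀ : ℝ, 0 < δ → 0 ≤ t₀ → ∃ W,
      ReachSlots G δ (⌊(t₀ + t) / δ⌋₊ - ⌊t₀ / δ⌋₊) W ∧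
      ∀ v, l2norm (V.mulVec v - W.mulVec v) ≤ L * δ * C * l2norm v) ?_ ?_
  · exact ⟨0, fun δ t₀ _ _ => ⟨1, by simpa using ReachSlots.one G δ, by simp [l2norm_zero]⟩⟩
  · rintro t V s A B hs hA hB hV ⟨L, hL⟩
    refine ⟨L + 1, fun δ t₀ hδ ht₀ => ?_⟩
    obtain ⟨W, hW, hVW⟩ := hL δ (t₀ + s) hδ (add_nonneg ht₀ hs)
    have hL := Matrix.kronecker_mem_unitary hA hB
    set n := ⌊(t₀ + s) / δ⌋₊ - ⌊t₀ / δ⌋₊ with hn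
    refine ⟨W * ((A ⊗ₖ B) * HamSim.evolution G (n * δ)), ?_, fun v => ?_⟩
    · have := ((ReachSlots.evolution G δ n).mul (.loc hA hB)).mul hW
      convert this using 1
      have h1 : ⌊t₀ / δ⌋₊ ≤ ⌊(t₀ + s) / δ⌋₊ := Nat.floor_le_floor (by gcongr; linarith)
      have h2 : ⌊(t₀ + s) / δ⌋₊ ≤ ⌊(t₀ + s + t) / δ⌋₊ :=
        Nat.floor_le_floor (div_le_div_of_nonneg_right (by linarith [hV.time_nonneg]) hδ.le)
      rw [← add_assoc]
      omega
    · have hE : l2norm ((HamSim.evolution G s).mulVec v - (HamSim.evolution G (n * δ)).mulVec v) ≤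
          δ * C * l2norm v := by
        refine (l2norm_evolution_sub_le_abs hG hC _ _ v).trans ?_
        have := hC.1
        have := l2norm_nonneg v
        gcongr
        exact abs_sub_floor_mul_le hδ hs ht₀
      refine (l2norm_sub_le _ (V.mulVec ((A ⊗ₖ B).mulVec
        ((HamSim.evolution G (n * δ)).mulVec v))) _).trans ?_
      rw [← Matrix.mulVec_mulVec, ← Matrix.mulVec_mulVec, ← Matrix.mulVec_mulVec,
        ← Matrix.mulVec_mulVec, ← Matrix.mulVec_sub, ← Matrix.mulVec_sub,
        l2norm_mulVec_unitary (hV.mem_unitary hG), l2norm_mulVec_unitary hL]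
      refine (add_le_add hE (hVW _)).trans_eq ?_
      rw [l2norm_mulVec_unitary hL, l2norm_mulVec_unitary (evolution_mem_unitary hG _)]
      push_cast
      ring

end Slots

/-! ### Simulation in the presence of a reference system. -/

noncomputable section Extend

variable {a b a' b' m n w z : Type*} [Fintype a] [DecidableEq a] [Fintype b] [DecidableEq b]
  [Fintype a'] [DecidableEq a'] [Fintype b'] [DecidableEq b']
  [Fintype m] [DecidableEq m] [Fintype n] [DecidableEq n]
  [Fintype w] [DecidableEq w] [Fintype z] [DecidableEq z]

lemma l2norm_le_of_homogeneous {ι κ : Type*} [Fintype ι] [Fintype κ] {F : (ι → ℂ) → κ → ℂ}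
    (hF : ∀ (c : ℂ) ψ, F (c • ψ) = c • F ψ) {ε : ℝ} (h : ∀ ψ, l2norm ψ = 1 → l2norm (F ψ) ≤ ε)
    (ψ : ι → ℂ) : l2norm (F ψ) ≤ ε * l2norm ψ := by
  by_cases h0 : l2norm ψ = 0
  · have : ψ = 0 := l2norm_eq_zero.1 h0
    have h1 := hF 0 0
    simp only [zero_smul] at h1
    rw [this, h1, l2norm_zero, l2norm_zero, mul_zero]
  · have hpos : 0 < l2norm ψ := (l2norm_nonneg ψ).lt_of_ne' h0
    have h1 := h (((l2norm ψ)⁻¹ : ℝ) • ψ) (by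
      rw [← Complex.coe_smul, l2norm_smul, Complex.norm_real, Real.norm_of_nonneg (by positivity),
        inv_mul_cancel₀ h0])
    rw [← Complex.coe_smul, hF, l2norm_smul, Complex.norm_real,
      Real.norm_of_nonneg (by positivity), inv_mul_le_iff₀ hpos] at h1
    linarith

lemma seqProd_withAncillas_submatrix {x y x' y' : Type*} [Fintype x] [DecidableEq x] [Fintype y]
    [DecidableEq y] [Fintype x'] [DecidableEq x'] [Fintype y'] [DecidableEq y'] (E : x' ≃ x × w)
    (F : y' ≃ y × z) (V : ℕ → Matrix (x × y) (x × y) ℂ) (k : ℕ) :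
    seqProd (fun i => (withAncillas w z (V i)).submatrix (Prod.map E F) (Prod.map E F)) k =
      (withAncillas w z (seqProd V k)).submatrix (Equiv.prodCongr E F) (Equiv.prodCongr E F) := by
  refine seqProd_map (fun M : Matrix _ _ ℂ => (withAncillas w z M).submatrix (Equiv.prodCongr E F)
      (Equiv.prodCongr E F)) ?_ (fun M N => ?_) V k
  · change ((ancillaHom w z 1).submatrix _ _) = 1
    rw [map_one, Matrix.submatrix_one_equiv]
  · change ((ancillaHom w z (M * N)).submatrix _ _) = _
    rw [map_mul, Matrix.submatrix_mul_equiv]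
    rfl

/-- The final state `χ` does not depend on the input, so the bound applies to each slice of an input
entangled with the reference. Slices are orthogonal and the bound is homogeneous, so the error does
not grow. -/
lemma SimData.extend {H : Matrix (a × b) (a × b) ℂ} {H' : Matrix (a' × b') (a' × b') ℂ}
    {τ t ε : ℝ} (hε : 0 ≤ ε) {N : ℕ} (h : SimData m n H H' τ t N ε) :
    SimData m n H (withAncillas w z H') τ t N ε := by
  obtain ⟨α, β, V, hα, hβ, hV, h⟩ := h
  let E : a × ((a' × w) × m) ≃ (a × (a' × m)) × w :=
    ⟨fun p => ((p.1, (p.2.1.1, p.2.2)), p.2.1.2), fun q => (q.1.1, ((q.1.2.1, q.2), q.1.2.2)),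
      fun _ => rfl, fun _ => rfl⟩
  let F : b × ((b' × z) × n) ≃ (b × (b' × n)) × z :=
    ⟨fun p => ((p.1, (p.2.1.1, p.2.2)), p.2.1.2), fun q => (q.1.1, ((q.1.2.1, q.2), q.1.2.2)),
      fun _ => rfl, fun _ => rfl⟩
  refine ⟨α, β, fun k => (withAncillas w z (V k)).submatrix (Prod.map E F)
    (Prod.map E F), hα, hβ, fun k hk => ?_, fun k hk => ?_⟩
  · have := ((hV k hk).withAncillas (u := w) (v := z)).submatrix E F
    convert this using 1
    · ext p q
      simp only [withAncillas_apply, Matrix.submatrix_apply, Matrix.one_apply, Prod.ext_iff, E, F,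
        Prod.map_fst, Prod.map_snd, Equiv.coe_fn_mk]
      split_ifs <;> simp_all
  · obtain ⟨χ, hχ, h⟩ := h k hk
    refine ⟨χ, hχ, fun Φ hΦ => ?_⟩
    rw [seqProd_withAncillas_submatrix, evolution_withAncillas, ← l2norm_comp_equiv (Equiv.prodCongr E F).symm,
      l2norm_slices (u := w) (v := z), ← mul_one ε, ← hΦ, l2norm_slices Φ]
    refine l2norm_le_of_slices hε fun r => ?_
    have hhom := l2norm_le_of_homogeneous (F := fun ψ : a' × b' → ℂ =>
      (seqProd V k).mulVec (jointState ψ fun q : (a × m) × (b × n) => α q.1 * β q.2) -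
        jointState ((evolution H' (k * τ)).mulVec ψ) χ) (fun c ψ => by
          rw [jointState_smul_left, Matrix.mulVec_smul, Matrix.mulVec_smul, jointState_smul_left,
            smul_sub]) h (fun q => Φ ((q.1, r.1), (q.2, r.2)))
    refine le_of_eq_of_le ?_ hhom
    congr 1
    ext i
    simp only [Matrix.submatrix_mulVec_equiv, Pi.sub_apply, Function.comp_apply,
      Equiv.apply_symm_apply, withAncillas_mulVec]
    congr 1
    simp [jointState, withAncillas_mulVec, E, F]

lemma Simulates.extend {H : Matrix (a × b) (a × b) ℂ} {H' : Matrix (a' × b') (a' × b') ℂ} {r : ℝ}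
    (h : Simulates H H' r) : Simulates H (withAncillas w z H') r := by
  rw [simulates_iff] at h ⊢
  refine ⟨h.1, fun τ N ε hτ hε => ?_⟩
  obtain ⟨m, n, h⟩ := h.2 τ N ε hτ hε
  exact ⟨m, n, h.extend hε.le⟩

end Extend

/-! ### Composition of simulations. -/

noncomputable section Trans

variable {a b a' b' a'' b'' m n p q : Type*} [Fintype a] [DecidableEq a] [Fintype b] [DecidableEq b]
  [Fintype a'] [DecidableEq a'] [Fintype b'] [DecidableEq b']
  [Fintype a''] [DecidableEq a''] [Fintype b''] [DecidableEq b'']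
  [Fintype m] [DecidableEq m] [Fintype n] [DecidableEq n]
  [Fintype p] [DecidableEq p] [Fintype q] [DecidableEq q]

/-- Each block of a simulation maps one checkpoint to the next, on arbitrary register states. -/
lemma SimData.exists_chain {H : Matrix (a × b) (a × b) ℂ} {H' : Matrix (a' × b') (a' × b') ℂ}
    (hH : H.IsHermitian) (hH' : H'.IsHermitian) {τ t ε : ℝ} {N : ℕ}
    (h : SimData m n H H' τ t N ε) :
    ∃ (α : a × m → ℂ) (β : b × n → ℂ) (V : ℕ → Matrix ((a × (a' × m)) × (b × (b' × n)))
        ((a × (a' × m)) × (b × (b' × n))) ℂ) (χ : ℕ → (a × m) × (b × n) → ℂ),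
      l2norm α = 1 ∧ l2norm β = 1 ∧
      (∀ k, k < N → Reach (withAncillas (a' × m) (b' × n) H) t (V k)) ∧
      (∀ k, k ≤ N → l2norm (χ k) = 1) ∧
      (∀ ψ : a' × b' → ℂ, l2norm ψ = 1 →
        l2norm (jointState ψ (fun q => α q.1 * β q.2) - jointState ψ (χ 0)) ≤ ε) ∧
      ∀ k, k < N → ∀ ψ : a' × b' → ℂ,
        l2norm ((V k).mulVec (jointState ψ (χ k)) -
          jointState ((evolution H' τ).mulVec ψ) (χ (k + 1))) ≤ 2 * ε * l2norm ψ := by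
  obtain ⟨α, β, V, hα, hβ, hV, h⟩ := h
  choose! χ hχ h using h
  refine ⟨α, β, V, χ, hα, hβ, hV, hχ, fun ψ hψ => ?_, fun k hk => ?_⟩
  · simpa [seqProd, evolution_zero_time] using h 0 N.zero_le ψ hψ
  · refine l2norm_le_of_homogeneous (fun c ψ => ?_) fun ψ hψ => ?_
    · rw [jointState_smul_left, Matrix.mulVec_smul, Matrix.mulVec_smul, jointState_smul_left,
        smul_sub]
    -- The input is evolved backwards so that checkpoint `k` finds the register in `ψ`. The errors
    -- at checkpoints `k` and `k + 1` give the factor `2`.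
    · set φ := (evolution H' (-(k * τ))).mulVec ψ with hφ
      have hφ1 : l2norm φ = 1 := by
        rw [hφ, l2norm_mulVec_unitary (evolution_mem_unitary hH' _), hψ]
      clear_value φ
      have e1 : (evolution H' (k * τ)).mulVec φ = ψ := by
        rw [hφ, Matrix.mulVec_mulVec, ← evolution_add, add_neg_cancel, evolution_zero_time,
          Matrix.one_mulVec]
      have e2 : (evolution H' ((k + 1 : ℕ) * τ)).mulVec φ = (evolution H' τ).mulVec ψ := by
        rw [← e1, Matrix.mulVec_mulVec, ← evolution_add]
        congr 2
        push_cast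
        ring
      have h1 := h k hk.le φ hφ1
      have h2 := h (k + 1) hk φ hφ1
      rw [e1] at h1
      rw [e2, seqProd, ← Matrix.mulVec_mulVec] at h2
      have hU := (hV k hk).mem_unitary (withAncillas_isHermitian hH)
      refine (l2norm_sub_le _ ((V k).mulVec ((seqProd V k).mulVec
        (jointState φ fun q => α q.1 * β q.2))) _).trans ?_
      rw [← Matrix.mulVec_sub, l2norm_mulVec_unitary hU, l2norm_sub_comm]
      linarith

/-- Each slot is replaced by the next unused block, and local unitaries act directly on the
register. The statement holds from any checkpoint `k`, because the side systems have moved on to `χ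
k` by then; unitarity makes the errors add. -/
lemma ReachSlots.simulate {H : Matrix (a × b) (a × b) ℂ} {K : Matrix (a' × b') (a' × b') ℂ}
    (hH : H.IsHermitian) (hK : K.IsHermitian) {δ t ε : ℝ} {N : ℕ}
    {V : ℕ → Matrix ((a × (a' × m)) × (b × (b' × n))) ((a × (a' × m)) × (b × (b' × n))) ℂ}
    {χ : ℕ → (a × m) × (b × n) → ℂ}
    (hV : ∀ k, k < N → Reach (withAncillas (a' × m) (b' × n) H) t (V k))
    (h : ∀ k, k < N → ∀ ψ : a' × b' → ℂ, l2norm ((V k).mulVec (jointState ψ (χ k)) -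
          jointState ((HamSim.evolution K δ).mulVec ψ) (χ (k + 1))) ≤ ε * l2norm ψ)
    {l : ℕ} {W : Matrix (a' × b') (a' × b') ℂ} (hW : ReachSlots K δ l W) :
    W ∈ Matrix.unitaryGroup (a' × b') ℂ ∧ ∀ k, k + l ≤ N →
      ∃ X, Reach (withAncillas (a' × m) (b' × n) H) (l * t) X ∧ ∀ ψ : a' × b' → ℂ,
        l2norm (X.mulVec (jointState ψ (χ k)) - jointState (W.mulVec ψ) (χ (k + l))) ≤
          l * ε * l2norm ψ := by
  induction hW with
  | @loc A B hA hB =>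
    refine ⟨Matrix.kronecker_mem_unitary hA hB, fun k _ => ?_⟩
    have hloc := Reach.loc (withAncillas (a' × m) (b' × n) H)
      (Matrix.kronecker_mem_unitary (one_mem (Matrix.unitaryGroup a ℂ))
        (Matrix.kronecker_mem_unitary hA (one_mem (Matrix.unitaryGroup m ℂ))))
      (Matrix.kronecker_mem_unitary (one_mem (Matrix.unitaryGroup b ℂ))
        (Matrix.kronecker_mem_unitary hB (one_mem (Matrix.unitaryGroup n ℂ))))
    refine ⟨_, by simpa using hloc, fun ψ => ?_⟩
    rw [kronecker_eq_jointOp, jointOp_mulVec, Matrix.one_kronecker_one, Matrix.one_kronecker_one,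
      Matrix.one_kronecker_one, Matrix.one_mulVec, add_zero, sub_self, l2norm_zero]
    simp
  | slot =>
    exact ⟨evolution_mem_unitary hK δ, fun k hk =>
      ⟨V k, by simpa using hV k hk, fun ψ => by simpa using h k hk ψ⟩⟩
  | @mul i j V₁ V₂ _ _ ih₁ ih₂ =>
    refine ⟨mul_mem ih₂.1 ih₁.1, fun k hk => ?_⟩
    obtain ⟨X₁, hX₁, h₁⟩ := ih₁.2 k (by omega)
    obtain ⟨X₂, hX₂, h₂⟩ := ih₂.2 (k + i) (by omega)
    refine ⟨X₂ * X₁, ?_, fun ψ => ?_⟩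
    · rw [Nat.cast_add, add_mul]
      exact hX₁.mul hX₂
    · rw [← Matrix.mulVec_mulVec, ← Matrix.mulVec_mulVec, ← add_assoc]
      refine (l2norm_sub_le _ (X₂.mulVec (jointState (V₁.mulVec ψ) (χ (k + i)))) _).trans ?_
      rw [← Matrix.mulVec_sub,
        l2norm_mulVec_unitary (hX₂.mem_unitary (withAncillas_isHermitian hH))]
      have := h₂ (V₁.mulVec ψ)
      rw [l2norm_mulVec_unitary ih₁.1] at this
      refine (add_le_add (h₁ ψ) this).trans_eq ?_
      push_cast
      ring

set_option synthInstance.maxSize 1024 in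
/-- A simulation whose ancillas contain a register of its own. -/
lemma SimData.of_nested {x y : Type*} [Fintype x] [DecidableEq x] [Fintype y] [DecidableEq y]
    (ex : x ≃ a' × (a'' × p)) (ey : y ≃ b' × (b'' × q))
    {H : Matrix (a × b) (a × b) ℂ} {H'' : Matrix (a'' × b'') (a'' × b'') ℂ}
    {τ t ε : ℝ} {N : ℕ} {α : a × m → ℂ} {β : b × n → ℂ} {α' : a' × p → ℂ} {β' : b' × q → ℂ}
    (hα : l2norm α = 1) (hβ : l2norm β = 1) (hα' : l2norm α' = 1) (hβ' : l2norm β' = 1)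
    (V : ℕ → Matrix ((a × (x × m)) × (b × (y × n))) ((a × (x × m)) × (b × (y × n))) ℂ)
    (hV : ∀ k, k < N → Reach (withAncillas (x × m) (y × n) H) t (V k))
    (χ : ℕ → (a × m) × (b × n) → ℂ) (χ' : ℕ → (a' × p) × (b' × q) → ℂ)
    (hχ : ∀ k, k ≤ N → l2norm (χ k) = 1) (hχ' : ∀ k, k ≤ N → l2norm (χ' k) = 1)
    (h : ∀ k, k ≤ N → ∀ ψ : a'' × b'' → ℂ, l2norm ψ = 1 →
      l2norm ((seqProd V k).mulVec (jointState
          (fun z => jointState ψ (fun z => α' z.1 * β' z.2) (ex z.1, ey z.2))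
          fun z => α z.1 * β z.2) -
        jointState (fun z => jointState ((evolution H'' (k * τ)).mulVec ψ) (χ' k) (ex z.1, ey z.2))
          (χ k)) ≤ ε) :
    SimData ((a' × p) × m) ((b' × q) × n) H H'' τ t N ε := by
  let E : a'' × ((a' × p) × m) ≃ x × m :=
    ⟨fun z => (ex.symm (z.2.1.1, (z.1, z.2.1.2)), z.2.2),
      fun z => ((ex z.1).2.1, (((ex z.1).1, (ex z.1).2.2), z.2)),
      fun _ => by simp, fun _ => by simp⟩
  let F : b'' × ((b' × q) × n) ≃ y × n :=
    ⟨fun z => (ey.symm (z.2.1.1, (z.1, z.2.1.2)), z.2.2),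
      fun z => ((ey z.1).2.1, (((ey z.1).1, (ey z.1).2.2), z.2)),
      fun _ => by simp, fun _ => by simp⟩
  let P := Equiv.prodCongr (Equiv.prodCongr (.refl a) E) (Equiv.prodCongr (.refl b) F)
  have key : ∀ (ψ : a'' × b'' → ℂ) (μ' : (a' × p) × (b' × q) → ℂ) (μ : (a × m) × (b × n) → ℂ),
      jointState ψ (fun z : (a × ((a' × p) × m)) × (b × ((b' × q) × n)) =>
        μ' (z.1.2.1, z.2.2.1) * μ ((z.1.1, z.1.2.2), (z.2.1, z.2.2.2))) =
        fun z => jointState (fun z => jointState ψ μ' (ex z.1, ey z.2)) μ (P z) := by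
    intro ψ μ' μ
    ext z
    simp [jointState, P, E, F, mul_assoc]
  have hprod : (fun z : (a × ((a' × p) × m)) × (b × ((b' × q) × n)) =>
      (α' z.1.2.1 * α (z.1.1, z.1.2.2)) * (β' z.2.2.1 * β (z.2.1, z.2.2.2))) =
      fun z => (fun y => α' y.1 * β' y.2) (z.1.2.1, z.2.2.1) *
        (fun y => α y.1 * β y.2) ((z.1.1, z.1.2.2), (z.2.1, z.2.2.2)) := by
    ext z
    exact mul_mul_mul_comm _ _ _ _
  refine ⟨fun z => α' z.2.1 * α (z.1, z.2.2), fun z => β' z.2.1 * β (z.1, z.2.2),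
    fun k => (V k).submatrix P P, ?_, ?_, ?_, ?_⟩
  · let e : a × ((a' × p) × m) ≃ (a' × p) × (a × m) :=
      ⟨fun z => (z.2.1, (z.1, z.2.2)), fun z => (z.2.1, (z.1, z.2.2)), fun _ => rfl, fun _ => rfl⟩
    rw [← one_mul 1]
    nth_rw 1 [← hα']
    rw [← hα, ← l2norm_mul]
    exact l2norm_comp_equiv e fun z => α' z.1 * α z.2
  · let e : b × ((b' × q) × n) ≃ (b' × q) × (b × n) :=
      ⟨fun z => (z.2.1, (z.1, z.2.2)), fun z => (z.2.1, (z.1, z.2.2)), fun _ => rfl, fun _ => rfl⟩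
    rw [← one_mul 1]
    nth_rw 1 [← hβ']
    rw [← hβ, ← l2norm_mul]
    exact l2norm_comp_equiv e fun z => β' z.1 * β z.2
  · intro k hk
    have := (hV k hk).submatrix (Equiv.prodCongr (.refl a) E) (Equiv.prodCongr (.refl b) F)
    rwa [withAncillas_submatrix H E F] at this
  · intro k hk
    refine ⟨fun z => χ' k (z.1.2.1, z.2.2.1) * χ k ((z.1.1, z.1.2.2), (z.2.1, z.2.2.2)), ?_,
      fun ψ hψ => ?_⟩
    · let e : (a × ((a' × p) × m)) × (b × ((b' × q) × n)) ≃
          ((a' × p) × (b' × q)) × ((a × m) × (b × n)) :=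
        ⟨fun z => ((z.1.2.1, z.2.2.1), ((z.1.1, z.1.2.2), (z.2.1, z.2.2.2))),
          fun z => ((z.2.1.1, (z.1.1, z.2.1.2)), (z.2.2.1, (z.1.2, z.2.2.2))),
          fun _ => rfl, fun _ => rfl⟩
      rw [← one_mul 1]
      nth_rw 1 [← hχ' k hk]
      rw [← hχ k hk, ← l2norm_mul]
      exact l2norm_comp_equiv e fun z => χ' k z.1 * χ k z.2
    · rw [seqProd_submatrix, hprod, key ψ (fun y => α' y.1 * β' y.2) (fun y => α y.1 * β y.2), key,
        Matrix.submatrix_mulVec_equiv]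
      have e1 : ∀ f : (a × (x × m)) × (b × (y × n)) → ℂ, (fun z => f (P z)) ∘ P.symm = f :=
        fun f => by ext z; rw [Function.comp_apply, Equiv.apply_symm_apply]
      rw [e1]
      refine le_of_eq_of_le ?_ (h k hk ψ hψ)
      clear_value P
      exact l2norm_comp_equiv P (_ - _)

/-- A protocol that uses `K` can be run with `H` instead if `H` simulates `K`. -/
lemma Simulates.exists_run {H : Matrix (a × b) (a × b) ℂ} {K : Matrix (a' × b') (a' × b') ℂ}
    {r : ℝ} (hH : H.IsHermitian) (hK : K.IsHermitian) (h : Simulates H K r) {T : ℝ} (hTpos : 0 < T)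
    {N : ℕ} {W : ℕ → Matrix (a' × b') (a' × b') ℂ} (hW : ∀ k < N, Reach K T (W k)) {ε : ℝ}
    (hε : 0 < ε) :
    ∃ (m n : ℕ) (α : a × Fin m → ℂ) (β : b × Fin n → ℂ)
      (X : ℕ → Matrix ((a × (a' × Fin m)) × (b × (b' × Fin n)))
        ((a × (a' × Fin m)) × (b × (b' × Fin n))) ℂ) (χ : ℕ → (a × Fin m) × (b × Fin n) → ℂ),
      l2norm α = 1 ∧ l2norm β = 1 ∧
      (∀ k < N, Reach (withAncillas (a' × Fin m) (b' × Fin n) H) (T / r) (X k)) ∧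
      (∀ k ≤ N, l2norm (χ k) = 1) ∧
      ∀ k ≤ N, ∀ Φ : a' × b' → ℂ, l2norm Φ = 1 →
        l2norm ((seqProd X k).mulVec (jointState Φ fun z => α z.1 * β z.2) -
          jointState ((seqProd W k).mulVec Φ) (χ k)) ≤ ε := by
  have hr : 0 < r := h.1
  obtain ⟨C, hC⟩ := exists_opBound K
  have hslots := fun k hk => (hW k hk).exists_slots hK hC
  choose! L hL using hslots
  set Lm := ∑ k ∈ Finset.range N, L k with hLm
  have hC0 := hC.1
  -- With `M` slots per block, rounding all `N` blocks costs at most `ε / 2` in total.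
  obtain ⟨M, hM⟩ := exists_nat_gt (N * (Lm * T * C) * 2 / ε)
  have hMpos : (0 : ℝ) < M := lt_of_le_of_lt (by positivity) hM
  set δ := T / M with hδ
  have hδpos : 0 < δ := div_pos hTpos hMpos
  have hround : N * (Lm * δ * C) ≤ ε / 2 := by
    rw [div_lt_iff₀ hε] at hM
    rw [hδ, show (N * (Lm * (T / M) * C) : ℝ) = N * (Lm * T * C) / M by ring, div_le_iff₀ hMpos]
    linarith
  -- As `T` is exactly `M` slots, each simulated block uses `H` for exactly `M * (δ / r) = T / r`,
  -- as the definition of a simulation demands.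
  have hfloor : ⌊(0 + T) / δ⌋₊ - ⌊(0 : ℝ) / δ⌋₊ = M := by
    rw [zero_add, hδ, div_div_cancel₀ hTpos.ne', zero_div, Nat.floor_zero, Nat.floor_natCast,
      Nat.sub_zero]
  have hW' : ∀ k < N, ∃ W', ReachSlots K δ M W' ∧
      ∀ v, l2norm ((W k).mulVec v - W'.mulVec v) ≤ Lm * δ * C * l2norm v := by
    intro k hk
    obtain ⟨W', h1, h2⟩ := hL k hk δ 0 hδpos le_rfl
    rw [hfloor] at h1
    refine ⟨W', h1, fun v => (h2 v).trans ?_⟩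
    have : L k ≤ Lm := Finset.single_le_sum (f := L) (fun _ _ => Nat.zero_le _)
      (Finset.mem_range.2 hk)
    have := l2norm_nonneg v
    gcongr
  choose! W' hW'slots hW'close using hW'
  -- There are `N * M` slots, each with chain error `2 * ε'`, and one further `ε'` for replacing the
  -- initial product state by `χ 0`: `ε / 2` altogether.
  set ε' := ε / (2 * (2 * (N * M) + 1)) with hε'
  have hε'pos : 0 < ε' := by positivity
  obtain ⟨m, n, h1⟩ := ((simulates_iff _ _ _).1 h).2 δ (N * M) ε' hδpos hε'pos
  obtain ⟨α, β, V, χ, hα, hβ, hV, hχ, hstart, hchain⟩ := h1.exists_chain hH hK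
  have hidx : ∀ k, k < N → k * M + M ≤ N * M := fun k hk => by
    rw [← Nat.succ_mul]; exact Nat.mul_le_mul_right M hk
  have hX := fun k (hk : k < N) =>
    ((hW'slots k hk).simulate hH hK hV hchain).2 (k * M) (hidx k hk)
  choose! X hXreach hX using hX
  have hprod : ∀ k, k ≤ N → ∀ Φ : a' × b' → ℂ, l2norm Φ = 1 →
      l2norm ((seqProd X k).mulVec (jointState Φ (χ 0)) -
        jointState ((seqProd W k).mulVec Φ) (χ (k * M))) ≤ k * (M * (2 * ε') + Lm * δ * C) ∧
      l2norm ((seqProd W k).mulVec Φ) = 1 := by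
    intro k hk Φ hΦ
    induction k with
    | zero => simp [seqProd, l2norm_zero, hΦ]
    | succ k ih =>
      have hk' : k < N := hk
      obtain ⟨ih1, ih2⟩ := ih hk'.le
      have hXk := hX k hk' ((seqProd W k).mulVec Φ)
      have hWk := hW'close k hk' ((seqProd W k).mulVec Φ)
      rw [ih2, mul_one] at hXk hWk
      rw [seqProd, seqProd, ← Matrix.mulVec_mulVec, ← Matrix.mulVec_mulVec]
      refine ⟨?_, by rw [l2norm_mulVec_unitary ((hW k hk').mem_unitary hK), ih2]⟩
      have s1 := l2norm_sub_le ((X k).mulVec ((seqProd X k).mulVec (jointState Φ (χ 0))))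
        ((X k).mulVec (jointState ((seqProd W k).mulVec Φ) (χ (k * M))))
        (jointState ((W k).mulVec ((seqProd W k).mulVec Φ)) (χ ((k + 1) * M)))
      have s2 := l2norm_sub_le
        ((X k).mulVec (jointState ((seqProd W k).mulVec Φ) (χ (k * M))))
        (jointState ((W' k).mulVec ((seqProd W k).mulVec Φ)) (χ (k * M + M)))
        (jointState ((W k).mulVec ((seqProd W k).mulVec Φ)) (χ ((k + 1) * M)))
      rw [← Matrix.mulVec_sub, l2norm_mulVec_unitary
        ((hXreach k hk').mem_unitary (withAncillas_isHermitian hH))] at s1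
      rw [Nat.succ_mul, ← jointState_sub_left, l2norm_jointState, hχ _ (hidx k hk'), mul_one,
        l2norm_sub_comm ((W' k).mulVec _)] at s2
      rw [Nat.succ_mul] at s1 ⊢
      push_cast
      linarith
  have hXu : ∀ k, k ≤ N → ∀ v, l2norm ((seqProd X k).mulVec v) = l2norm v := by
    intro k hk v
    induction k with
    | zero => simp [seqProd]
    | succ k ih =>
      rw [seqProd, ← Matrix.mulVec_mulVec, l2norm_mulVec_unitary
        ((hXreach k hk).mem_unitary (withAncillas_isHermitian hH)), ih (Nat.le_of_succ_le hk)]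
  refine ⟨m, n, α, β, X, fun k => χ (k * M), hα, hβ, fun k hk => ?_,
    fun k hk => hχ _ (Nat.mul_le_mul_right M hk), fun k hk Φ hΦ => ?_⟩
  · convert hXreach k hk using 1
    rw [hδ]
    field_simp
  · have s1 := l2norm_sub_le ((seqProd X k).mulVec (jointState Φ fun z => α z.1 * β z.2))
      ((seqProd X k).mulVec (jointState Φ (χ 0))) (jointState ((seqProd W k).mulVec Φ) (χ (k * M)))
    rw [← Matrix.mulVec_sub, hXu k hk] at s1
    have s2 := hstart Φ hΦ
    have s3 := (hprod k hk Φ hΦ).1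
    have hkN : (k : ℝ) ≤ N := Nat.cast_le.2 hk
    have hb : k * (M * (2 * ε') + Lm * δ * C) ≤ N * (M * (2 * ε') + Lm * δ * C) := by
      gcongr
    have hε'' : (2 * (N * M) + 1) * ε' = ε / 2 := by
      rw [hε']
      field_simp
    linarith

/-- The protocol for `H''` acts on `H'` together with ancillas. By `Simulates.extend`, `H` simulates
`H'` there too, so the protocol can be run with `H`, the time being divided by `s` and then by `r`.
The two simulations share the error equally. -/
theorem Simulates.trans {H : Matrix (a × b) (a × b) ℂ} {H' : Matrix (a' × b') (a' × b') ℂ}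
    {H'' : Matrix (a'' × b'') (a'' × b'') ℂ} {r s : ℝ} (hH : H.IsHermitian) (hH' : H'.IsHermitian)
    (h₁ : Simulates H H' r) (h₂ : Simulates H' H'' s) : Simulates H H'' (r * s) := by
  rw [simulates_iff] at h₂ ⊢
  obtain ⟨hs, h₂⟩ := h₂
  have hr : 0 < r := h₁.1
  refine ⟨mul_pos hr hs, fun τ N ε hτ hε => ?_⟩
  obtain ⟨p, q, α', β', W, hα', hβ', hW, h₂⟩ := h₂ τ N (ε / 2) hτ (half_pos hε)
  choose! χ' hχ' h₂ using h₂
  obtain ⟨m, n, α, β, X, χ, hα, hβ, hX, hχ, h₁⟩ := h₁.extend.exists_run hH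
    (withAncillas_isHermitian hH') (div_pos hτ hs) hW (half_pos hε)
  refine SimData.exists_fin (SimData.of_nested (.refl _) (.refl _) hα hβ hα' hβ' X
    (fun k hk => ?_) χ χ' hχ hχ' fun k hk ψ hψ => ?_)
  · rw [mul_comm, ← div_div]
    exact hX k hk
  · have hΨ : l2norm (jointState ψ fun z : (a' × Fin p) × (b' × Fin q) => α' z.1 * β' z.2) = 1 := by
      rw [l2norm_jointState, hψ, l2norm_mul, hα', hβ', one_mul, one_mul]
    have s1 := h₁ k hk _ hΨ
    have s2 := h₂ k hk ψ hψ
    refine (l2norm_sub_le _ (jointState ((seqProd W k).mulVec (jointState ψ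
        fun z : (a' × Fin p) × (b' × Fin q) => α' z.1 * β' z.2)) (χ k)) _).trans ?_
    refine (add_le_add s1 (le_of_eq_of_le ?_ s2)).trans_eq (add_halves ε)
    refine (congrArg l2norm (jointState_sub_left _ _ (χ k)).symm).trans ?_
    rw [l2norm_jointState _ (χ k), hχ k hk, mul_one]
    rfl

end Trans

/-! ### An entanglement bound on Ising rates. -/

noncomputable section Bound

variable {a b m n x y : Type*} [Fintype a] [DecidableEq a] [Fintype b] [DecidableEq b]
  [Fintype m] [DecidableEq m] [Fintype n] [DecidableEq n]
  [Fintype x] [DecidableEq x] [Fintype y] [DecidableEq y]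

/-- Deleting the evolutions leaves a product unitary, and deleting one of duration `s` costs at most
`s * C`. -/
lemma Reach.exists_local {G : Matrix (x × y) (x × y) ℂ} (hG : G.IsHermitian) {C : ℝ}
    (hC : OpBound G C) {t : ℝ} {V : Matrix (x × y) (x × y) ℂ} (h : Reach G t V) :
    ∃ A ∈ Matrix.unitaryGroup x ℂ, ∃ B ∈ Matrix.unitaryGroup y ℂ,
      ∀ v, l2norm (V.mulVec v - (A ⊗ₖ B).mulVec v) ≤ t * C * l2norm v := by
  refine h.induction (p := fun t V => ∃ A ∈ Matrix.unitaryGroup x ℂ,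
    ∃ B ∈ Matrix.unitaryGroup y ℂ,
      ∀ v, l2norm (V.mulVec v - (A ⊗ₖ B).mulVec v) ≤ t * C * l2norm v) ?_ ?_
  · exact ⟨1, one_mem _, 1, one_mem _, fun v => by simp [l2norm_zero]⟩
  · rintro t V s A B hs hA hB hV ⟨A', hA', B', hB', ih⟩
    refine ⟨A' * A, mul_mem hA' hA, B' * B, mul_mem hB' hB, fun v => ?_⟩
    have hAB := Matrix.kronecker_mem_unitary hA hB
    have hE := l2norm_evolution_sub_le hG hC hs v
    rw [evolution_zero_time, Matrix.one_mulVec, sub_zero] at hE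
    rw [Matrix.mul_kronecker_mul, ← Matrix.mulVec_mulVec, ← Matrix.mulVec_mulVec,
      ← Matrix.mulVec_mulVec]
    refine (l2norm_sub_le _ (V.mulVec ((A ⊗ₖ B).mulVec v)) _).trans ?_
    have h2 := ih ((A ⊗ₖ B).mulVec v)
    rw [l2norm_mulVec_unitary hAB] at h2
    rw [← Matrix.mulVec_sub, ← Matrix.mulVec_sub, l2norm_mulVec_unitary (hV.mem_unitary hG),
      l2norm_mulVec_unitary hAB]
    linarith

lemma l2norm_comp_le {ι κ : Type*} [Fintype ι] [Fintype κ] {f : ι → κ} (hf : f.Injective)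
    (v : κ → ℂ) : l2norm (fun i => v (f i)) ≤ l2norm v := by
  classical
  refine (sq_le_sq₀ (l2norm_nonneg _) (l2norm_nonneg _)).1 ?_
  rw [l2norm_sq, l2norm_sq, ← Finset.sum_image (f := fun k => ‖v k‖ ^ 2) (g := f) (s := Finset.univ)
    (fun i _ j _ h => hf h)]
  exact Finset.sum_le_sum_of_subset_of_nonneg (Finset.subset_univ _) fun _ _ _ => by positivity

/-- The component of a vector in which the two register qubits are in the basis state `i`, `j`. -/
def qubitSlice (i j : Fin 2) (v : (a × (Fin 2 × m)) × (b × (Fin 2 × n)) → ℂ) :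
    (a × m) × (b × n) → ℂ :=
  fun z => v ((z.1.1, (i, z.1.2)), (z.2.1, (j, z.2.2)))

lemma l2norm_qubitSlice_le (i j : Fin 2) (v : (a × (Fin 2 × m)) × (b × (Fin 2 × n)) → ℂ) :
    l2norm (qubitSlice i j v) ≤ l2norm v := by
  refine l2norm_comp_le (f := fun z : (a × m) × (b × n) =>
    ((z.1.1, (i, z.1.2)), (z.2.1, (j, z.2.2)))) ?_ v
  rintro ⟨⟨_, _⟩, ⟨_, _⟩⟩ ⟨⟨_, _⟩, ⟨_, _⟩⟩ h
  simpa [Prod.ext_iff] using h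

/-- The `2 × 2` minor of an entangled register state bounds its distance from product states. -/
lemma norm_minor_le {f : a × (Fin 2 × m) → ℂ} {g : b × (Fin 2 × n) → ℂ} {φ : Fin 2 × Fin 2 → ℂ}
    {χ : (a × m) × (b × n) → ℂ} (hf : l2norm f = 1) (hg : l2norm g = 1) (hφ : l2norm φ = 1)
    (hχ : l2norm χ = 1) :
    ‖φ (0, 0) * φ (1, 1) - φ (0, 1) * φ (1, 0)‖ ≤
      4 * l2norm ((fun p => f p.1 * g p.2) - jointState φ χ) := by
  set F : (a × (Fin 2 × m)) × (b × (Fin 2 × n)) → ℂ := fun p => f p.1 * g p.2 with hF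
  set G : (a × (Fin 2 × m)) × (b × (Fin 2 × n)) → ℂ := jointState φ χ with hG
  have hF1 : l2norm F = 1 := by rw [hF, l2norm_mul, hf, hg, one_mul]
  have hG1 : l2norm G = 1 := by rw [hG, l2norm_jointState, hφ, hχ, one_mul]
  -- The weight satisfies `s z * χ z ^ 2 = ‖χ z‖ ^ 2`, including where `χ z = 0` and the division
  -- gives zero. The bilinear form `B` thus removes `χ` from slices of `jointState φ χ` and leaves
  -- the products of the entries of `φ`.
  let s : (a × m) × (b × n) → ℂ := fun z => star (χ z) ^ 2 / (‖χ z‖ ^ 2 : ℝ)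
  have hs : ∀ z, ‖s z‖ ≤ 1 := by
    intro z
    simp only [s, norm_div, norm_pow, norm_star, Complex.norm_real, norm_norm]
    exact div_self_le_one _
  have hsχ : ∀ z, s z * (χ z * χ z) = (‖χ z‖ ^ 2 : ℝ) := by
    intro z
    by_cases h : χ z = 0
    · simp [h]
    · have h' : ((‖χ z‖ ^ 2 : ℝ) : ℂ) ≠ 0 := by
        simpa using h
      simp only [s]
      rw [div_mul_eq_mul_div, div_eq_iff h']
      have : star (χ z) * χ z = ((‖χ z‖ ^ 2 : ℝ) : ℂ) := by
        rw [Complex.star_def, Complex.conj_mul']; push_cast; rfl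
      rw [← this]
      ring
  let B : ((a × m) × (b × n) → ℂ) → ((a × m) × (b × n) → ℂ) → ℂ :=
    fun v w => ∑ z, s z * (v z * w z)
  have hGB : ∀ i j k l, B (qubitSlice i j G) (qubitSlice k l G) = φ (i, j) * φ (k, l) := by
    intro i j k l
    have : ∀ z, s z * (qubitSlice i j G z * qubitSlice k l G z) =
        φ (i, j) * φ (k, l) * ((‖χ z‖ ^ 2 : ℝ) : ℂ) := by
      intro z
      rw [← hsχ]
      simp only [qubitSlice, hG, jointState]
      ring
    simp only [B, this]
    rw [← Finset.mul_sum, ← Complex.ofReal_sum, ← l2norm_sq, hχ]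
    simp
  -- For a product vector the minor already vanishes pointwise, before summing.
  have hFB : B (qubitSlice 0 0 F) (qubitSlice 1 1 F) = B (qubitSlice 0 1 F) (qubitSlice 1 0 F) := by
    refine Finset.sum_congr rfl fun z _ => ?_
    simp only [qubitSlice, hF]
    ring
  -- Each of the two products in the minor changes by at most twice the distance, one contribution
  -- per argument of `B`; hence the constant `4`.
  have hdiff : ∀ i j k l, ‖B (qubitSlice i j F) (qubitSlice k l F) -
      B (qubitSlice i j G) (qubitSlice k l G)‖ ≤ 2 * l2norm (F - G) := by
    intro i j k l
    have e : B (qubitSlice i j F) (qubitSlice k l F) - B (qubitSlice i j G) (qubitSlice k l G) =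
        B (qubitSlice i j (F - G)) (qubitSlice k l F) +
          B (qubitSlice i j G) (qubitSlice k l (F - G)) := by
      simp only [B]
      rw [← Finset.sum_sub_distrib, ← Finset.sum_add_distrib]
      refine Finset.sum_congr rfl fun z _ => ?_
      simp only [qubitSlice, Pi.sub_apply]
      ring
    rw [e]
    refine (norm_add_le _ _).trans ?_
    have h1 := norm_sum_mul_le s (qubitSlice i j (F - G)) (qubitSlice k l F) hs
    have h2 := norm_sum_mul_le s (qubitSlice i j G) (qubitSlice k l (F - G)) hs
    have h3 := l2norm_qubitSlice_le i j (F - G)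
    have h4 := l2norm_qubitSlice_le k l F
    have h5 := l2norm_qubitSlice_le i j G
    have h6 := l2norm_qubitSlice_le k l (F - G)
    rw [hF1] at h4
    rw [hG1] at h5
    have h7 := mul_le_mul h3 h4 (l2norm_nonneg _) (l2norm_nonneg _)
    have h8 := mul_le_mul h5 h6 (l2norm_nonneg _) zero_le_one
    linarith
  have h1 := hdiff 0 0 1 1
  have h2 := hdiff 0 1 1 0
  rw [hGB] at h1 h2
  rw [← hFB] at h2
  calc ‖φ (0, 0) * φ (1, 1) - φ (0, 1) * φ (1, 0)‖
      = ‖(B (qubitSlice 0 0 F) (qubitSlice 1 1 F) - φ (0, 1) * φ (1, 0)) -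
          (B (qubitSlice 0 0 F) (qubitSlice 1 1 F) - φ (0, 0) * φ (1, 1))‖ := by
        congr 1; ring
    _ ≤ _ := norm_sub_le _ _
    _ ≤ _ := by linarith

/-- The signs of the two basis states of a qubit. -/
def qubitSign (i : Fin 2) : ℝ := if i = 0 then 1 else -1

lemma ising_eq_diagHam : ising = diagHam fun i j => qubitSign i * qubitSign j := by
  ext ⟨i, j⟩ ⟨k, l⟩
  fin_cases i <;> fin_cases j <;> fin_cases k <;> fin_cases l <;>
    simp [ising, sigmaZ, diagHam, qubitSign]

lemma isingLike_ising : IsingLike (fun i j => qubitSign i * qubitSign j) 1 := by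
  refine ⟨zero_le_one, 0, 0, fun i j => qubitSign i * qubitSign j, by simp,
    ⟨fun i j => qubitSign i * qubitSign j, subset_convexHull ℝ _
      ⟨qubitSign, qubitSign, fun i => ?_, fun i => ?_, rfl⟩, by simp⟩, 0, 1, 0, 1, ?_⟩
  · unfold qubitSign; split_ifs <;> simp
  · unfold qubitSign; split_ifs <;> simp
  · simp [qubitSign]

/-- The amplitude `1 / √2`. -/
def invSqrtTwo : ℂ := ((Real.sqrt 2)⁻¹ : ℝ)

lemma invSqrtTwo_mul_self : invSqrtTwo * invSqrtTwo = 1 / 2 := by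
  rw [invSqrtTwo, ← Complex.ofReal_mul, ← mul_inv, Real.mul_self_sqrt (by norm_num)]
  norm_num

lemma l2norm_invSqrtTwo : l2norm (fun _ : Fin 2 => invSqrtTwo) = 1 := by
  rw [← sq_eq_sq₀ (l2norm_nonneg _) zero_le_one, l2norm_sq]
  simp [invSqrtTwo]

/-- The state of one party when its register qubit is in the state `(|0⟩ + |1⟩) / √2`. -/
def withPlus (γ : a × m → ℂ) : a × (Fin 2 × m) → ℂ := fun p => invSqrtTwo * γ (p.1, p.2.2)

lemma l2norm_withPlus (γ : a × m → ℂ) : l2norm (withPlus γ) = l2norm γ := by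
  let e : a × (Fin 2 × m) ≃ Fin 2 × (a × m) :=
    ⟨fun p => (p.2.1, (p.1, p.2.2)), fun p => (p.2.1, (p.1, p.2.2)), fun _ => rfl, fun _ => rfl⟩
  rw [← one_mul (l2norm γ), ← l2norm_invSqrtTwo, ← l2norm_mul]
  exact l2norm_comp_equiv e fun p => invSqrtTwo * γ p.2

lemma l2norm_plusPlus : l2norm (fun _ : Fin 2 × Fin 2 => invSqrtTwo * invSqrtTwo) = 1 := by
  rw [l2norm_mul (fun _ : Fin 2 => invSqrtTwo) (fun _ : Fin 2 => invSqrtTwo), l2norm_invSqrtTwo,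
    one_mul]

/-- At time `π / 4` the two products in the minor are `-i / 4` and `i / 4`, so they add up in
absolute value. -/
lemma norm_minor_ising {φ : Fin 2 × Fin 2 → ℂ}
    (hφ : φ = (evolution ising (Real.pi / 4)).mulVec fun _ => invSqrtTwo * invSqrtTwo) :
    ‖φ (0, 0) * φ (1, 1) - φ (0, 1) * φ (1, 0)‖ = 1 / 2 := by
  have e1 : Complex.exp (-(Complex.I * (Real.pi / 4 : ℝ))) ^ 2 = -Complex.I := by
    rw [← Complex.exp_nat_mul, show ((2 : ℕ) : ℂ) * -(Complex.I * (Real.pi / 4 : ℝ)) =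
      -Real.pi / 2 * Complex.I by push_cast; ring, Complex.exp_neg_pi_div_two_mul_I]
  have e2 : Complex.exp (Complex.I * (Real.pi / 4 : ℝ)) ^ 2 = Complex.I := by
    rw [← Complex.exp_nat_mul, show ((2 : ℕ) : ℂ) * (Complex.I * (Real.pi / 4 : ℝ)) =
      Real.pi / 2 * Complex.I by push_cast; ring, Complex.exp_pi_div_two_mul_I]
  have e3 : φ (0, 0) * φ (1, 1) - φ (0, 1) * φ (1, 0) = -Complex.I / 2 := by
    rw [hφ, ising_eq_diagHam, evolution_diagHam_mulVec]
    simp only [qubitSign, invSqrtTwo_mul_self, if_true, if_neg (show (1 : Fin 2) ≠ 0 by decide),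
      mul_one, mul_neg, neg_neg, Complex.ofReal_neg]
    linear_combination (1 / 4 : ℂ) * e1 - (1 / 4 : ℂ) * e2
  rw [e3]
  simp

lemma jointState_plusPlus (α : a × m → ℂ) (β : b × n → ℂ) :
    jointState (fun _ : Fin 2 × Fin 2 => invSqrtTwo * invSqrtTwo) (fun q => α q.1 * β q.2) =
      fun p => withPlus α p.1 * withPlus β p.2 := by
  ext p
  exact mul_mul_mul_comm _ _ _ _

/-- The rates at which a Hamiltonian can simulate the Ising interaction are bounded. -/
theorem exists_bound_simulates_ising {H : Matrix (a × b) (a × b) ℂ} (hH : H.IsHermitian) :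
    ∃ C : ℝ, ∀ r, Simulates H ising r → r ≤ C := by
  obtain ⟨C, hC⟩ := exists_opBound H
  -- With accuracy `1 / 16` and time `π / (4 r)`, the minor estimate reads `1 / 2 ≤ 4 * (1 / 16 + π
  -- * C / (4 r))`, that is `r ≤ 4 π C`.
  refine ⟨4 * Real.pi * C, fun r hr => ?_⟩
  have hpos : 0 < r := hr.1
  obtain ⟨m, n, α, β, V, hα, hβ, hV, h⟩ := ((simulates_iff _ _ _).1 hr).2 (Real.pi / 4) 1 (1 / 16)
    (by positivity) (by norm_num)
  obtain ⟨χ, hχ, h⟩ := h 1 le_rfl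
  obtain ⟨A, hA, B, hB, hV⟩ := (hV 0 zero_lt_one).exists_local (withAncillas_isHermitian hH)
    hC.withAncillas
  have h1 := h _ l2norm_plusPlus
  have h2 := hV (jointState (fun _ => invSqrtTwo * invSqrtTwo) fun q => α q.1 * β q.2)
  rw [l2norm_jointState, l2norm_plusPlus, l2norm_mul, hα, hβ, one_mul, one_mul, mul_one] at h2
  simp only [seqProd, mul_one, Nat.cast_one, one_mul] at h1
  rw [jointState_plusPlus] at h1 h2
  have hφ1 : l2norm ((evolution ising (Real.pi / 4)).mulVec
      fun _ => invSqrtTwo * invSqrtTwo) = 1 := by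
    rw [ising_eq_diagHam, l2norm_mulVec_unitary
      (evolution_mem_unitary (diagHam_isHermitian _) _), l2norm_plusPlus]
  have hval := norm_minor_ising rfl
  have hminor := norm_minor_le (f := A.mulVec (withPlus α)) (g := B.mulVec (withPlus β))
    (χ := χ) (by rw [l2norm_mulVec_unitary hA, l2norm_withPlus, hα])
    (by rw [l2norm_mulVec_unitary hB, l2norm_withPlus, hβ]) hφ1 hχ
  rw [hval, ← kronecker_mulVec_mul] at hminor
  have htri := l2norm_sub_le ((A ⊗ₖ B).mulVec fun p => withPlus α p.1 * withPlus β p.2)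
    ((V 0).mulVec fun p => withPlus α p.1 * withPlus β p.2)
    (jointState ((evolution ising (Real.pi / 4)).mulVec fun _ => invSqrtTwo * invSqrtTwo) χ)
  rw [l2norm_sub_comm] at h2
  have hfin : 1 / 16 ≤ Real.pi / 4 / r * C := by linarith
  rw [div_mul_eq_mul_div, le_div_iff₀ hpos] at hfin
  linarith

end Bound

/-! ### Convex hulls of sign products and additivity of the strength. -/

noncomputable section Convexity

variable {a b a' b' : Type*}

lemma comp_mem_convexHull_signProducts {m : a → b → ℝ} (hm : m ∈ convexHull ℝ (signProducts a b))
    (κ : a' → a) (μ : b' → b) :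
    (fun k l => m (κ k) (μ l)) ∈ convexHull ℝ (signProducts a' b') := by
  refine convexHull_min (t := {m | (fun k l => m (κ k) (μ l)) ∈ convexHull ℝ (signProducts a' b')})
    ?_ ?_ hm
  · rintro _ ⟨x, y, hx, hy, rfl⟩
    exact subset_convexHull ℝ _ ⟨x ∘ κ, y ∘ μ, fun k => hx _, fun l => hy _, rfl⟩
  · intro m₁ h₁ m₂ h₂ p q hp hq hpq
    exact convex_convexHull ℝ _ h₁ h₂ hp hq hpq

lemma mem_convexHull_signs [Finite a] {x : a → ℝ} (hx : ∀ k, |x k| ≤ 1) :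
    x ∈ convexHull ℝ {x : a → ℝ | ∀ k, x k = 1 ∨ x k = -1} := by
  have h1 : {x : a → ℝ | ∀ k, x k = 1 ∨ x k = -1} =
      Set.univ.pi fun _ => ({1, -1} : Set ℝ) := by
    ext x; simp
  rw [h1, convexHull_pi]
  intro k _
  rw [convexHull_pair, segment_symm, segment_eq_Icc (by norm_num)]
  exact abs_le.1 (hx k)

/-- A cube is the convex hull of its vertices. Since the product is linear in each factor
separately, the hull can be taken in one factor at a time. -/
lemma mul_mem_convexHull_signProducts [Finite a] [Finite b] {x : a → ℝ} {y : b → ℝ}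
    (hx : ∀ k, |x k| ≤ 1) (hy : ∀ l, |y l| ≤ 1) :
    (fun k l => x k * y l) ∈ convexHull ℝ (signProducts a b) := by
  refine convexHull_min (t := {y | (fun k l => x k * y l) ∈ convexHull ℝ (signProducts a b)}) ?_ ?_
    (mem_convexHull_signs hy)
  · intro y hy
    refine convexHull_min (t := {x | (fun k l => x k * y l) ∈ convexHull ℝ (signProducts a b)})
      ?_ ?_ (mem_convexHull_signs hx)
    · intro x hx
      exact subset_convexHull ℝ _ ⟨x, y, hx, hy, rfl⟩
    · intro x₁ h₁ x₂ h₂ p q hp hq hpq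
      have := convex_convexHull ℝ _ h₁ h₂ hp hq hpq
      rw [Set.mem_ofPred_eq]
      convert this using 1
      ext k l
      simp only [Pi.add_apply, Pi.smul_apply, smul_eq_mul]
      ring
  · intro y₁ h₁ y₂ h₂ p q hp hq hpq
    have := convex_convexHull ℝ _ h₁ h₂ hp hq hpq
    rw [Set.mem_ofPred_eq]
    convert this using 1
    ext k l
    simp only [Pi.add_apply, Pi.smul_apply, smul_eq_mul]
    ring

lemma exists_mem_sum_smul_eq {ι E : Type*} [Fintype ι] [AddCommGroup E] [Module ℝ E] {S : Set E}
    (hS : Convex ℝ S) (hne : S.Nonempty) {c : ι → ℝ} (hc : ∀ i, 0 ≤ c i) {m : ι → E}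
    (hm : ∀ i, m i ∈ S) : ∃ x ∈ S, ∑ i, c i • m i = (∑ i, c i) • x := by
  rcases (Finset.sum_nonneg fun i (_ : i ∈ Finset.univ) => hc i).eq_or_lt with h | h
  · obtain ⟨x, hx⟩ := hne
    have h0 := (Finset.sum_eq_zero_iff_of_nonneg fun i _ => hc i).1 h.symm
    refine ⟨x, hx, ?_⟩
    rw [← h, zero_smul]
    exact Finset.sum_eq_zero fun i hi => by rw [h0 i hi, zero_smul]
  · refine ⟨∑ i, (c i / ∑ j, c j) • m i, hS.sum_mem (fun i _ => div_nonneg (hc i) h.le) ?_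
      fun i _ => hm i, ?_⟩
    · rw [← Finset.sum_div, div_self h.ne']
    · rw [Finset.smul_sum]
      refine Finset.sum_congr rfl fun i _ => ?_
      rw [smul_smul, mul_div_cancel₀ _ h.ne']

lemma signProducts_nonempty : (signProducts a b).Nonempty :=
  ⟨_, fun _ => 1, fun _ => 1, by simp, by simp, rfl⟩

/-- `s` is the midpoint and `d` half the spread. The extremes are stated as `d * y = ±d` so that
constant `x`, where `d = 0` and `y = 0`, needs no exception. -/
lemma exists_affine_normalization [Finite a] [Nonempty a] (x : a → ℝ) :
    ∃ (s d : ℝ) (y : a → ℝ), 0 ≤ d ∧ (∀ k, x k = s + d * y k) ∧ (∀ k, |y k| ≤ 1) ∧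
      ∃ k₀ k₁, d * y k₀ = d ∧ d * y k₁ = -d := by
  obtain ⟨k₀, h₀⟩ := Finite.exists_max x
  obtain ⟨k₁, h₁⟩ := Finite.exists_min x
  have hd : 0 ≤ (x k₀ - x k₁) / 2 := by linarith [h₀ k₁]
  rcases hd.eq_or_lt with h | h
  · refine ⟨x k₀, 0, 0, le_rfl, fun k => ?_, by simp, k₀, k₁, by simp, by simp⟩
    have := h₀ k
    have := h₁ k
    simp only [Pi.zero_apply, mul_zero, add_zero]
    linarith
  · have key : ∀ k, (x k₀ - x k₁) / 2 * ((x k - (x k₀ + x k₁) / 2) / ((x k₀ - x k₁) / 2)) =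
        x k - (x k₀ + x k₁) / 2 := fun k => mul_div_cancel₀ _ h.ne'
    refine ⟨(x k₀ + x k₁) / 2, (x k₀ - x k₁) / 2,
      fun k => (x k - (x k₀ + x k₁) / 2) / ((x k₀ - x k₁) / 2), h.le, fun k => ?_, fun k => ?_,
      k₀, k₁, ?_, ?_⟩
    · rw [key]; ring
    · rw [abs_div, abs_of_pos h, div_le_one h, abs_le]
      constructor <;> linarith [h₀ k, h₁ k]
    · rw [key]; ring
    · rw [key]; ring

/-- Expanding `(s + d x') (s' + d' y')`, every term but `d d' x' y'` depends on one index only. -/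
lemma isingLike_mul [Finite a] [Nonempty a] [Finite b] [Nonempty b] (x : a → ℝ) (y : b → ℝ) :
    ∃ c, IsingLike (fun k l => x k * y l) c := by
  obtain ⟨s, d, x', hd, hx, hx', k₀, k₁, hk₀, hk₁⟩ := exists_affine_normalization x
  obtain ⟨s', d', y', hd', hy, hy', l₀, l₁, hl₀, hl₁⟩ := exists_affine_normalization y
  refine ⟨d * d', mul_nonneg hd hd', fun k => s * s' + s' * (d * x' k), fun l => s * (d' * y' l),
    fun k l => d * x' k * (d' * y' l), fun k l => ?_,
    ⟨_, mul_mem_convexHull_signProducts hx' hy', fun k l => by ring⟩, k₀, k₁, l₀, l₁, ?_⟩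
  · dsimp only
    rw [hx, hy]
    ring
  · simp only [hk₀, hk₁, hl₀, hl₁]
    simp

/-- Corners are chosen independently in each component, so all summands reach their extremes
together and the strengths add without loss. The normalised parts combine with weights proportional
to the strengths. -/
lemma IsingLike.sum {ι : Type*} [Fintype ι] {a b : ι → Type*} {e : ∀ i, a i → b i → ℝ}
    {c : ι → ℝ} (h : ∀ i, IsingLike (e i) (c i)) :
    IsingLike (fun (k : ∀ i, a i) (l : ∀ i, b i) => ∑ i, e i (k i) (l i)) (∑ i, c i) := by
  have hc := fun i => (h i).1
  have h' := fun i => (h i).2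
  choose f g n he hn k₀ k₁ l₀ l₁ h₀₀ h₀₁ h₁₀ h₁₁ using h'
  choose m hm hnm using hn
  obtain ⟨x, hx, hsum⟩ := exists_mem_sum_smul_eq (convex_convexHull ℝ _)
    (signProducts_nonempty.mono (subset_convexHull ℝ _)) hc
    (fun i => comp_mem_convexHull_signProducts (hm i) (fun k : ∀ i, a i => k i)
      (fun l : ∀ i, b i => l i))
  refine ⟨Finset.sum_nonneg fun i _ => hc i, fun k => ∑ i, f i (k i), fun l => ∑ i, g i (l i),
    fun k l => ∑ i, n i (k i) (l i), fun k l => ?_, ⟨x, hx, fun k l => ?_⟩, k₀, k₁, l₀, l₁, ?_⟩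
  · simp only [he, Finset.sum_add_distrib]
  · have := congrFun (congrFun hsum k) l
    simp only [Finset.sum_apply, Pi.smul_apply, smul_eq_mul] at this
    rw [← this]
    exact Finset.sum_congr rfl fun i _ => hnm i _ _
  · simp [h₀₀, h₀₁, h₁₀, h₁₁]

lemma IsingLike.add {a₁ b₁ a₂ b₂ : Type*} {e₁ : a₁ → b₁ → ℝ} {e₂ : a₂ → b₂ → ℝ} {c₁ c₂ : ℝ}
    (h₁ : IsingLike e₁ c₁) (h₂ : IsingLike e₂ c₂) :
    IsingLike (fun (k : a₁ × a₂) (l : b₁ × b₂) => e₁ k.1 l.1 + e₂ k.2 l.2) (c₁ + c₂) := by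
  obtain ⟨hc₁, f₁, g₁, n₁, he₁, ⟨m₁, hm₁, hn₁⟩, k₀, k₁, l₀, l₁, h₀₀, h₀₁, h₁₀, h₁₁⟩ := h₁
  obtain ⟨hc₂, f₂, g₂, n₂, he₂, ⟨m₂, hm₂, hn₂⟩, k₀', k₁', l₀', l₁', h₀₀', h₀₁', h₁₀', h₁₁'⟩ := h₂
  obtain ⟨x, hx, hsum⟩ := exists_mem_sum_smul_eq (convex_convexHull ℝ (signProducts _ _))
    (signProducts_nonempty.mono (subset_convexHull ℝ _)) (c := ![c₁, c₂])
    (Fin.forall_fin_two.2 ⟨hc₁, hc₂⟩)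
    (m := ![fun (k : a₁ × a₂) (l : b₁ × b₂) => m₁ k.1 l.1,
      fun (k : a₁ × a₂) (l : b₁ × b₂) => m₂ k.2 l.2])
    (Fin.forall_fin_two.2 ⟨comp_mem_convexHull_signProducts hm₁ Prod.fst Prod.fst,
      comp_mem_convexHull_signProducts hm₂ Prod.snd Prod.snd⟩)
  refine ⟨add_nonneg hc₁ hc₂, fun k => f₁ k.1 + f₂ k.2, fun l => g₁ l.1 + g₂ l.2,
    fun k l => n₁ k.1 l.1 + n₂ k.2 l.2, fun k l => ?_, ⟨x, hx, fun k l => ?_⟩,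
    (k₀, k₀'), (k₁, k₁'), (l₀, l₀'), (l₁, l₁'), ?_⟩
  · dsimp only
    rw [he₁, he₂]
    ring
  · have := congrFun (congrFun hsum k) l
    simp only [Fin.sum_univ_two, Matrix.cons_val_zero, Matrix.cons_val_one, Pi.add_apply,
      Pi.smul_apply, smul_eq_mul] at this
    dsimp only
    rw [hn₁, hn₂, this]
  · simp only [h₀₀, h₀₁, h₁₀, h₁₁, h₀₀', h₀₁', h₁₀', h₁₁']
    refine ⟨trivial, ?_, ?_, trivial⟩ <;> ring

end Convexity

/-! ### Ising strength determines the optimal rates. -/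

noncomputable section Spectral

variable {a b a' b' : Type*} [Fintype a] [DecidableEq a] [Fintype b] [DecidableEq b]
  [Fintype a'] [DecidableEq a'] [Fintype b'] [DecidableEq b']

/-- Up to local unitaries, `H` is diagonal with Ising-like eigenvalues of strength `c`. -/
def HasIsingStrength (H : Matrix (a × b) (a × b) ℂ) (c : ℝ) : Prop :=
  ∃ A ∈ Matrix.unitaryGroup a ℂ, ∃ B ∈ Matrix.unitaryGroup b ℂ, ∃ e : a → b → ℝ,
    H = (A ⊗ₖ B) * diagHam e * star (A ⊗ₖ B) ∧ IsingLike e c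

variable {H : Matrix (a × b) (a × b) ℂ} {H' : Matrix (a' × b') (a' × b') ℂ} {c c' : ℝ}

lemma HasIsingStrength.nonneg (h : HasIsingStrength H c) : 0 ≤ c := by
  obtain ⟨_, _, _, _, _, _, h⟩ := h
  exact h.1

lemma HasIsingStrength.isHermitian (h : HasIsingStrength H c) : H.IsHermitian := by
  obtain ⟨A, _, B, _, e, rfl, _⟩ := h
  exact Matrix.isHermitian_mul_mul_conjTranspose _ (diagHam_isHermitian e)

lemma hasIsingStrength_ising : HasIsingStrength ising 1 :=
  ⟨1, one_mem _, 1, one_mem _, _, by simp [ising_eq_diagHam], isingLike_ising⟩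

lemma HasIsingStrength.simulates (h : HasIsingStrength H c) (h' : HasIsingStrength H' c')
    (hc : 0 < c) (hc' : 0 < c') : Simulates H H' (c / c') := by
  obtain ⟨A, hA, B, hB, e, rfl, he⟩ := h
  obtain ⟨A', hA', B', hB', e', rfl, he'⟩ := h'
  exact (simulates_diagHam he he' hc hc').conj hA hB hA' hB'

lemma HasIsingStrength.isLocal (h : HasIsingStrength H 0) : IsLocalHamiltonian H := by
  obtain ⟨A, hA, B, hB, e, rfl, -, f, g, n, he, ⟨m, -, hn⟩, -⟩ := h
  refine ⟨A * (Matrix.diagonal fun k => (f k : ℂ)) * star A,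
    B * (Matrix.diagonal fun l => (g l : ℂ)) * star B,
    Matrix.isHermitian_mul_mul_conjTranspose _ ?_,
    Matrix.isHermitian_mul_mul_conjTranspose _ ?_, ?_⟩
  · rw [Matrix.isHermitian_diagonal_iff]
    intro k
    simp [IsSelfAdjoint]
  · rw [Matrix.isHermitian_diagonal_iff]
    intro k
    simp [IsSelfAdjoint]
  · have hD : diagHam e = (Matrix.diagonal fun k => (f k : ℂ)) ⊗ₖ (1 : Matrix b b ℂ) +
        (1 : Matrix a a ℂ) ⊗ₖ (Matrix.diagonal fun l => (g l : ℂ)) := by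
      rw [← Matrix.diagonal_one, ← Matrix.diagonal_one, Matrix.diagonal_kronecker_diagonal,
        Matrix.diagonal_kronecker_diagonal, Matrix.diagonal_add, diagHam]
      congr 1
      ext p
      rw [he, hn]
      push_cast
      ring
    rw [hD, mul_add, add_mul, Matrix.star_eq_conjTranspose (A ⊗ₖ B),
      Matrix.conjTranspose_kronecker, ← Matrix.mul_kronecker_mul, ← Matrix.mul_kronecker_mul,
      ← Matrix.mul_kronecker_mul, ← Matrix.mul_kronecker_mul, mul_one, mul_one,
      ← Matrix.star_eq_conjTranspose, ← Matrix.star_eq_conjTranspose,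
      Matrix.mem_unitaryGroup_iff.1 hA, Matrix.mem_unitaryGroup_iff.1 hB]

lemma HasIsingStrength.pos_of_not_isLocal (h : HasIsingStrength H c)
    (hH : ¬ IsLocalHamiltonian H) : 0 < c := by
  refine h.nonneg.lt_of_ne ?_
  rintro rfl
  exact hH h.isLocal

lemma simulates_pow {q : ℝ} (hH : H.IsHermitian) (h : Simulates H H q) (k : ℕ) :
    Simulates H H (q ^ (k + 1)) := by
  induction k with
  | zero => simpa using h
  | succ k ih =>
    rw [pow_succ]
    exact ih.trans hH hH h

lemma HasIsingStrength.rate_le (h : HasIsingStrength H c) (h' : HasIsingStrength H' c')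
    (hc' : 0 < c') {r : ℝ} (hr : Simulates H H' r) : r ≤ c / c' := by
  have hI := h'.simulates hasIsingStrength_ising hc' one_pos
  rcases h.nonneg.eq_or_lt with rfl | hc
  · exfalso
    obtain ⟨C, hC⟩ := exists_bound_simulates_ising
      (H := (0 : Matrix (Fin 1 × Fin 1) (Fin 1 × Fin 1) ℂ)) Matrix.isHermitian_zero
    -- Chosen so that the composed rate from the zero Hamiltonian to the Ising interaction is `|C| +
    -- 1`, above the bound `C`.
    have hx : 0 < (|C| + 1) / (r * (c' / 1)) := by
      have := hr.1
      positivity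
    have h0 := ((simulates_of_isLocal (Matrix.isHermitian_zero (n := Fin 1 × Fin 1) (α := ℂ))
      h.isLocal hx).trans Matrix.isHermitian_zero h.isHermitian
      (hr.trans h.isHermitian h'.isHermitian hI))
    have := hC _ h0
    rw [div_mul_cancel₀ _ (mul_pos hr.1 hI.1).ne'] at this
    linarith [le_abs_self C]
  · by_contra! hlt
    obtain ⟨C, hC⟩ := exists_bound_simulates_ising h'.isHermitian
    have hself := (h'.simulates h hc' hc).trans h'.isHermitian h.isHermitian hr
    have hq : 1 < c' / c * r := by
      rw [div_lt_iff₀ hc'] at hlt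
      rw [div_mul_eq_mul_div, lt_div_iff₀ hc]
      linarith
    -- After enough self-simulations the rate `q ^ (k + 1) * c'` for the Ising interaction, with `q
    -- = c' / c * r`, exceeds `C`.
    obtain ⟨k, hk⟩ := pow_unbounded_of_one_lt (C / c') hq
    have := hC _ ((simulates_pow h'.isHermitian hself k).trans h'.isHermitian h'.isHermitian hI)
    rw [div_one, ← le_div_iff₀ hc'] at this
    exact (hk.trans (pow_lt_pow_right₀ hq k.lt_succ_self)).not_ge this

lemma HasIsingStrength.simRate_eq (h : HasIsingStrength H c) (h' : HasIsingStrength H' c')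
    (hc' : 0 < c') : simRate H H' = ENNReal.ofReal (c / c') := by
  refine le_antisymm (sSup_le ?_) ?_
  · rintro _ ⟨r, hr, rfl⟩
    exact ENNReal.ofReal_le_ofReal (h.rate_le h' hc' hr)
  · rcases h.nonneg.eq_or_lt with rfl | hc
    · simp
    · exact le_sSup ⟨_, h.simulates h' hc hc', rfl⟩

lemma simRate_eq_top [Nonempty a] [Nonempty b] (hH : H.IsHermitian)
    (hH' : IsLocalHamiltonian H') : simRate H H' = ⊤ := by
  rw [simRate, sSup_eq_top]
  intro x hx
  refine ⟨_, ⟨x.toReal + 1, simulates_of_isLocal hH hH' (by positivity), rfl⟩, ?_⟩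
  rw [ENNReal.lt_ofReal_iff_toReal_lt hx.ne]
  exact lt_add_one _

lemma HasIsingStrength.kprod_eq (h : HasIsingStrength H c) : Kprod H = ENNReal.ofReal c := by
  rw [Kprod, h.simRate_eq hasIsingStrength_ising one_pos, div_one]

lemma HasIsingStrength.reversiblySimulates (h : HasIsingStrength H c)
    (h' : HasIsingStrength H' c') (hc : 0 < c) (hc' : 0 < c') : ReversiblySimulates H H' := by
  rw [ReversiblySimulates, h.simRate_eq h' hc', h'.simRate_eq h hc,
    ENNReal.toReal_ofReal (div_pos hc hc').le, ENNReal.toReal_ofReal (div_pos hc' hc).le,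
    ← ENNReal.ofReal_mul (div_pos hc hc').le, div_mul_div_cancel₀ hc'.ne', div_self hc.ne',
    ENNReal.ofReal_one]
  exact ⟨h.simulates h' hc hc', h'.simulates h hc' hc, rfl⟩

lemma IsProductHamiltonian.exists_isingStrength [Nonempty a] [Nonempty b]
    (h : IsProductHamiltonian H) : ∃ c, HasIsingStrength H c := by
  obtain ⟨HA, HB, hA, hB, rfl⟩ := h
  obtain ⟨c, hc⟩ := isingLike_mul hA.eigenvalues hB.eigenvalues
  refine ⟨c, hA.eigenvectorUnitary, hA.eigenvectorUnitary.2, hB.eigenvectorUnitary,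
    hB.eigenvectorUnitary.2, _, ?_, hc⟩
  have hD : diagHam (fun k l => hA.eigenvalues k * hB.eigenvalues l) =
      Matrix.diagonal (RCLike.ofReal ∘ hA.eigenvalues) ⊗ₖ
        Matrix.diagonal (RCLike.ofReal ∘ hB.eigenvalues) := by
    rw [Matrix.diagonal_kronecker_diagonal, diagHam]
    congr 1
    ext p
    simp
  rw [hD, Matrix.star_eq_conjTranspose, Matrix.conjTranspose_kronecker,
    ← Matrix.mul_kronecker_mul, ← Matrix.mul_kronecker_mul, ← Matrix.star_eq_conjTranspose,
    ← Matrix.star_eq_conjTranspose]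
  have h1 := hA.spectral_theorem
  have h2 := hB.spectral_theorem
  rw [Unitary.conjStarAlgAut_apply] at h1 h2
  exact congrArg₂ _ h1 h2

lemma HasIsingStrength.boxPlus {a₁ b₁ a₂ b₂ : Type*} [Fintype a₁] [DecidableEq a₁] [Fintype b₁]
    [DecidableEq b₁] [Fintype a₂] [DecidableEq a₂] [Fintype b₂] [DecidableEq b₂]
    {H₁ : Matrix (a₁ × b₁) (a₁ × b₁) ℂ} {H₂ : Matrix (a₂ × b₂) (a₂ × b₂) ℂ} {c₁ c₂ : ℝ}
    (h₁ : HasIsingStrength H₁ c₁) (h₂ : HasIsingStrength H₂ c₂) :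
    HasIsingStrength (boxPlus H₁ H₂) (c₁ + c₂) := by
  obtain ⟨A₁, hA₁, B₁, hB₁, e₁, rfl, he₁⟩ := h₁
  obtain ⟨A₂, hA₂, B₂, hB₂, e₂, rfl, he₂⟩ := h₂
  refine ⟨A₁ ⊗ₖ A₂, Matrix.kronecker_mem_unitary hA₁ hA₂, B₁ ⊗ₖ B₂,
    Matrix.kronecker_mem_unitary hB₁ hB₂, _, ?_, he₁.add he₂⟩
  have hU₁ := Matrix.kronecker_mem_unitary hA₁ hB₁
  have hU₂ := Matrix.kronecker_mem_unitary hA₂ hB₂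
  have hW : (A₁ ⊗ₖ A₂) ⊗ₖ (B₁ ⊗ₖ B₂) = ((A₁ ⊗ₖ B₁) ⊗ₖ (A₂ ⊗ₖ B₂)).submatrix
      (Equiv.prodProdProdComm a₁ a₂ b₁ b₂) (Equiv.prodProdProdComm a₁ a₂ b₁ b₂) := by
    ext p q
    exact mul_mul_mul_comm _ _ _ _
  have hD : diagHam (fun (k : a₁ × a₂) (l : b₁ × b₂) => e₁ k.1 l.1 + e₂ k.2 l.2) =
      (diagHam e₁ ⊗ₖ (1 : Matrix (a₂ × b₂) (a₂ × b₂) ℂ) +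
        (1 : Matrix (a₁ × b₁) (a₁ × b₁) ℂ) ⊗ₖ diagHam e₂).submatrix
      (Equiv.prodProdProdComm a₁ a₂ b₁ b₂) (Equiv.prodProdProdComm a₁ a₂ b₁ b₂) := by
    rw [← Matrix.diagonal_one, ← Matrix.diagonal_one, diagHam, diagHam, diagHam,
      Matrix.diagonal_kronecker_diagonal, Matrix.diagonal_kronecker_diagonal, Matrix.diagonal_add,
      Matrix.submatrix_diagonal_equiv]
    congr 1
    ext p
    simp
  rw [hW, hD, Matrix.star_eq_conjTranspose (Matrix.submatrix _ _ _),
    Matrix.conjTranspose_submatrix, Matrix.submatrix_mul_equiv, Matrix.submatrix_mul_equiv,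
    HamSim.boxPlus]
  congr 1
  rw [mul_add, add_mul, Matrix.conjTranspose_kronecker, ← Matrix.mul_kronecker_mul,
    ← Matrix.mul_kronecker_mul, ← Matrix.mul_kronecker_mul, ← Matrix.mul_kronecker_mul, mul_one,
    mul_one, ← Matrix.star_eq_conjTranspose, ← Matrix.star_eq_conjTranspose,
    Matrix.mem_unitaryGroup_iff.1 hU₁, Matrix.mem_unitaryGroup_iff.1 hU₂]

end Spectral

/-! ### Finite families of Hamiltonians. -/

noncomputable section Family

variable {ι : Type*} [Fintype ι] [DecidableEq ι]

/-- The tensor product of a family of matrices. -/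
def piKronecker {x : ι → Type*} (X : ∀ i, Matrix (x i) (x i) ℂ) :
    Matrix (∀ i, x i) (∀ i, x i) ℂ :=
  Matrix.of fun p q => ∏ i, X i (p i) (q i)

section Pi

variable {x : ι → Type*} [∀ i, Fintype (x i)] [∀ i, DecidableEq (x i)]

lemma piKronecker_mul (X Y : ∀ i, Matrix (x i) (x i) ℂ) :
    piKronecker X * piKronecker Y = piKronecker fun i => X i * Y i := by
  ext p q
  simp only [piKronecker, Matrix.mul_apply, Matrix.of_apply, ← Finset.prod_mul_distrib]
  rw [Finset.prod_univ_sum, Fintype.piFinset_univ]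

lemma piKronecker_one : piKronecker (fun i => (1 : Matrix (x i) (x i) ℂ)) = 1 := by
  ext p q
  simp only [piKronecker, Matrix.of_apply, Matrix.one_apply]
  rw [Finset.prod_ite_zero]
  simp [funext_iff]

lemma piKronecker_star (X : ∀ i, Matrix (x i) (x i) ℂ) :
    star (piKronecker X) = piKronecker fun i => star (X i) := by
  ext p q
  simp [piKronecker, Matrix.star_apply]

lemma piKronecker_mem_unitary {X : ∀ i, Matrix (x i) (x i) ℂ}
    (hX : ∀ i, X i ∈ Matrix.unitaryGroup (x i) ℂ) :
    piKronecker X ∈ Matrix.unitaryGroup (∀ i, x i) ℂ := by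
  rw [Matrix.mem_unitaryGroup_iff, piKronecker_star, piKronecker_mul]
  simp only [fun i => Matrix.mem_unitaryGroup_iff.1 (hX i), piKronecker_one]

end Pi

variable {a b : ι → Type*} [∀ i, Fintype (a i)] [∀ i, DecidableEq (a i)] [∀ i, Fintype (b i)]
  [∀ i, DecidableEq (b i)]

variable (a b) in
/-- Groups the systems of a family by index. -/
def pairEquiv : (∀ i, a i) × (∀ i, b i) ≃ ∀ i, a i × b i where
  toFun p i := (p.1 i, p.2 i)
  invFun q := (fun i => (q i).1, fun i => (q i).2)
  left_inv _ := rfl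
  right_inv _ := rfl

/-- As a sum of tensor products with a single nontrivial factor, the Hamiltonian can be conjugated
factor by factor. -/
lemma bigBoxPlus_eq_sum (H : ∀ i, Matrix (a i × b i) (a i × b i) ℂ) :
    bigBoxPlus H = (∑ i, piKronecker
      (Function.update (fun j => (1 : Matrix (a j × b j) (a j × b j) ℂ)) i (H i))).submatrix
        (pairEquiv a b) (pairEquiv a b) := by
  ext p q
  simp only [bigBoxPlus, Matrix.of_apply, Matrix.submatrix_apply, Matrix.sum_apply]
  refine Finset.sum_congr rfl fun i _ => ?_
  rw [piKronecker, Matrix.of_apply, ← Finset.mul_prod_erase _ _ (Finset.mem_univ i)]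
  have : ∀ j ∈ Finset.univ.erase i,
      Function.update (fun j => (1 : Matrix (a j × b j) (a j × b j) ℂ)) i (H i) j
        (pairEquiv a b p j) (pairEquiv a b q j) =
      if p.1 j = q.1 j ∧ p.2 j = q.2 j then 1 else 0 := by
    intro j hj
    rw [Function.update_of_ne (Finset.ne_of_mem_erase hj), Matrix.one_apply]
    simp [pairEquiv]
  rw [Finset.prod_congr rfl this, Finset.prod_ite_zero, Function.update_self]
  simp [pairEquiv]

lemma bigBoxPlus_diagHam (e : ∀ i, a i → b i → ℝ) :
    bigBoxPlus (fun i => diagHam (e i)) =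
      diagHam fun (k : ∀ i, a i) (l : ∀ i, b i) => ∑ i, e i (k i) (l i) := by
  ext p q
  simp only [bigBoxPlus, diagHam, Matrix.of_apply, Matrix.diagonal_apply]
  by_cases hpq : p = q
  · subst hpq
    simp
  · rw [if_neg hpq]
    refine Finset.sum_eq_zero fun i _ => ?_
    rw [ite_eq_right_iff]
    intro h
    rw [if_neg]
    intro hi
    simp only [Prod.mk.injEq] at hi
    refine hpq (Prod.ext (funext fun j => ?_) (funext fun j => ?_))
    · by_cases hj : j = i
      · subst hj; exact hi.1
      · exact (h j hj).1
    · by_cases hj : j = i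
      · subst hj; exact hi.2
      · exact (h j hj).2

lemma HasIsingStrength.bigBoxPlus {H : ∀ i, Matrix (a i × b i) (a i × b i) ℂ} {c : ι → ℝ}
    (h : ∀ i, HasIsingStrength (H i) (c i)) : HasIsingStrength (bigBoxPlus H) (∑ i, c i) := by
  choose A hA B hB e hH he using h
  refine ⟨piKronecker A, piKronecker_mem_unitary hA, piKronecker B, piKronecker_mem_unitary hB, _,
    ?_, IsingLike.sum he⟩
  have hW : piKronecker A ⊗ₖ piKronecker B = (piKronecker fun i => A i ⊗ₖ B i).submatrix
      (pairEquiv a b) (pairEquiv a b) := by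
    ext p q
    exact Finset.prod_mul_distrib.symm
  rw [hW, ← bigBoxPlus_diagHam, bigBoxPlus_eq_sum, bigBoxPlus_eq_sum, Matrix.star_eq_conjTranspose,
    Matrix.conjTranspose_submatrix, Matrix.submatrix_mul_equiv, Matrix.submatrix_mul_equiv,
    ← Matrix.star_eq_conjTranspose, piKronecker_star, Finset.mul_sum, Finset.sum_mul]
  congr 1
  refine Finset.sum_congr rfl fun i _ => ?_
  rw [piKronecker_mul, piKronecker_mul]
  congr 1
  ext1 j
  -- In factor `i` the unitaries diagonalise `H i`; in every other factor they cancel.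
  by_cases hj : j = i
  · subst hj
    rw [Function.update_self, Function.update_self, hH]
  · rw [Function.update_of_ne hj, Function.update_of_ne hj, mul_one, Matrix.mem_unitaryGroup_iff.1
      (Matrix.kronecker_mem_unitary (hA j) (hB j))]

end Family

end HamSim

theorem lemma3 :
    -- two product Hamiltonians on different pairs of systems simulating a product Hamiltonian
    (∀ {a₁ b₁ a₂ b₂ a' b' : Type*}
      [Fintype a₁] [DecidableEq a₁] [Nonempty a₁] [Fintype b₁] [DecidableEq b₁] [Nonempty b₁]
      [Fintype a₂] [DecidableEq a₂] [Nonempty a₂] [Fintype b₂] [DecidableEq b₂] [Nonempty b₂]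
      [Fintype a'] [DecidableEq a'] [Nonempty a'] [Fintype b'] [DecidableEq b'] [Nonempty b']
      (H₁ : Matrix (a₁ × b₁) (a₁ × b₁) ℂ) (H₂ : Matrix (a₂ × b₂) (a₂ × b₂) ℂ)
      (H' : Matrix (a' × b') (a' × b') ℂ),
      HamSim.IsProductHamiltonian H₁ → HamSim.IsProductHamiltonian H₂ →
      HamSim.IsProductHamiltonian H' →
        HamSim.simRate (HamSim.boxPlus H₁ H₂) H' =
          HamSim.simRate H₁ H' + HamSim.simRate H₂ H' ∧
        (¬ HamSim.IsLocalHamiltonian H' →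
          (¬ HamSim.IsLocalHamiltonian H₁ ∨ ¬ HamSim.IsLocalHamiltonian H₂) →
          HamSim.ReversiblySimulates (HamSim.boxPlus H₁ H₂) H')) ∧
    -- additivity of `K_⊗`
    (∀ {a₁ b₁ a₂ b₂ : Type*}
      [Fintype a₁] [DecidableEq a₁] [Nonempty a₁] [Fintype b₁] [DecidableEq b₁] [Nonempty b₁]
      [Fintype a₂] [DecidableEq a₂] [Nonempty a₂] [Fintype b₂] [DecidableEq b₂] [Nonempty b₂]
      (H₁ : Matrix (a₁ × b₁) (a₁ × b₁) ℂ) (H₂ : Matrix (a₂ × b₂) (a₂ × b₂) ℂ),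
      HamSim.IsProductHamiltonian H₁ → HamSim.IsProductHamiltonian H₂ →
        HamSim.Kprod (HamSim.boxPlus H₁ H₂) = HamSim.Kprod H₁ + HamSim.Kprod H₂) ∧
    -- sums of two finite families of product Hamiltonians simulating each other
    (∀ {ι κ : Type*} [Fintype ι] [DecidableEq ι] [Fintype κ] [DecidableEq κ]
      {a b : ι → Type*} {a' b' : κ → Type*}
      [∀ i, Fintype (a i)] [∀ i, DecidableEq (a i)] [∀ i, Nonempty (a i)]
      [∀ i, Fintype (b i)] [∀ i, DecidableEq (b i)] [∀ i, Nonempty (b i)]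
      [∀ j, Fintype (a' j)] [∀ j, DecidableEq (a' j)] [∀ j, Nonempty (a' j)]
      [∀ j, Fintype (b' j)] [∀ j, DecidableEq (b' j)] [∀ j, Nonempty (b' j)]
      (H : ∀ i, Matrix (a i × b i) (a i × b i) ℂ)
      (H' : ∀ j, Matrix (a' j × b' j) (a' j × b' j) ℂ),
      (∀ i, HamSim.IsProductHamiltonian (H i)) → (∀ j, HamSim.IsProductHamiltonian (H' j)) →
      (∃ j, ¬ HamSim.IsLocalHamiltonian (H' j)) →
        HamSim.simRate (HamSim.bigBoxPlus H) (HamSim.bigBoxPlus H') =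
          (∑ i, HamSim.Kprod (H i)) / (∑ j, HamSim.Kprod (H' j)) ∧
        ((∃ i, ¬ HamSim.IsLocalHamiltonian (H i)) →
          HamSim.ReversiblySimulates (HamSim.bigBoxPlus H) (HamSim.bigBoxPlus H'))) := by
  refine ⟨?_, ?_, ?_⟩
  · intro a₁ b₁ a₂ b₂ a' b' _ _ _ _ _ _ _ _ _ _ _ _ _ _ _ _ _ _ H₁ H₂ H' h₁ h₂ h'
    obtain ⟨c₁, hc₁⟩ := h₁.exists_isingStrength
    obtain ⟨c₂, hc₂⟩ := h₂.exists_isingStrength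
    obtain ⟨c', hc'⟩ := h'.exists_isingStrength
    have hsum := hc₁.boxPlus hc₂
    constructor
    -- A target of strength zero is local, and then both sides are infinite.
    · rcases hc'.nonneg.eq_or_lt with rfl | hpos
      · rw [HamSim.simRate_eq_top hsum.isHermitian hc'.isLocal,
          HamSim.simRate_eq_top hc₁.isHermitian hc'.isLocal,
          HamSim.simRate_eq_top hc₂.isHermitian hc'.isLocal, top_add]
      · rw [hsum.simRate_eq hc' hpos, hc₁.simRate_eq hc' hpos, hc₂.simRate_eq hc' hpos, add_div,
          ENNReal.ofReal_add (div_nonneg hc₁.nonneg hpos.le) (div_nonneg hc₂.nonneg hpos.le)]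
    · intro hnl' hnl
      refine hsum.reversiblySimulates hc' ?_ (hc'.pos_of_not_isLocal hnl')
      rcases hnl with hnl | hnl
      · exact add_pos_of_pos_of_nonneg (hc₁.pos_of_not_isLocal hnl) hc₂.nonneg
      · exact add_pos_of_nonneg_of_pos hc₁.nonneg (hc₂.pos_of_not_isLocal hnl)
  · intro a₁ b₁ a₂ b₂ _ _ _ _ _ _ _ _ _ _ _ _ H₁ H₂ h₁ h₂
    obtain ⟨c₁, hc₁⟩ := h₁.exists_isingStrength
    obtain ⟨c₂, hc₂⟩ := h₂.exists_isingStrength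
    rw [(hc₁.boxPlus hc₂).kprod_eq, hc₁.kprod_eq, hc₂.kprod_eq,
      ENNReal.ofReal_add hc₁.nonneg hc₂.nonneg]
  · intro ι κ _ _ _ _ a b a' b' _ _ _ _ _ _ _ _ _ _ _ _ H H' h h' hnl'
    choose c hc using fun i => (h i).exists_isingStrength
    choose c' hc' using fun j => (h' j).exists_isingStrength
    have hsum := HamSim.HasIsingStrength.bigBoxPlus hc
    have hsum' := HamSim.HasIsingStrength.bigBoxPlus hc'
    have hpos' : 0 < ∑ j, c' j := by
      obtain ⟨j, hj⟩ := hnl'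
      exact Finset.sum_pos' (fun j _ => (hc' j).nonneg)
        ⟨j, Finset.mem_univ j, (hc' j).pos_of_not_isLocal hj⟩
    refine ⟨?_, fun ⟨i, hi⟩ => hsum.reversiblySimulates hsum' ?_ hpos'⟩
    · rw [hsum.simRate_eq hsum' hpos', ENNReal.ofReal_div_of_pos hpos',
        ENNReal.ofReal_sum_of_nonneg fun i _ => (hc i).nonneg,
        ENNReal.ofReal_sum_of_nonneg fun j _ => (hc' j).nonneg]
      simp only [fun i => (hc i).kprod_eq, fun j => (hc' j).kprod_eq]
    · exact Finset.sum_pos' (fun i _ => (hc i).nonneg)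
        ⟨i, Finset.mem_univ i, (hc i).pos_of_not_isLocal hi⟩
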